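/- Strong unique continuation property. Let $\Omega\subset\mathbb{C}$ be open and connected with $0\in\Omega$, let $U\in L^2_{\mathrm{loc}}(\Omega,\mathbb{C})$, and let $1<p<2$. Write $\bar\partial=\tfrac12(\partial_x+i\partial_y)$ and $\partial=\tfrac12(\partial_x-i\partial_y)$ for $z=x+iy$, with derivatives in the weak (distributional) sense. Let $\psi=(\psi_1,\psi_2)\in W^{1,p}_{\mathrm{loc}}(\Omega,\mathbb{C}^2)$ lie in the kernel of the quaternionic holomorphic structure $\begin{pmatrix}\bar\partial & -\bar U\\ U & \partial\end{pmatrix}$ on $\Omega$, that is, $$\bar\partial\psi_1=\bar U\,\psi_2,\qquad \partial\psi_2=-U\,\psi_1\qquad\text{almost everywhere on }\Omega .$$ Put $|\psi|=(|\psi_1|^2+|\psi_2|^2)^{1/2}$. If for every $n\in\mathbb{N}$ $$\Big(\int_{B(0,\varepsilon)}|\psi|^{\frac{2p}{2-p}}\,d^2x\Big)^{\frac{2-p}{2p}}=O(\varepsilon^n)\qquad(\varepsilon\downarrow0),$$ then $\psi$ vanishes identically on $\Omega$ (i.e. $\psi=0$ almost everywhere on $\Omega$). -/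

import Mathlib

open MeasureTheory Filter Topology TopologicalSpace Metric
open scoped Distributions ENNReal ComplexConjugate

/-- Spinors: `ℂ²`-valued functions on the plane. The pair `(ψ₁, ψ₂)` is the quaternion
`!![ψ₁, -conj ψ₂; ψ₂, conj ψ₁]`, whose length is the Hermitian norm `√(|ψ₁|² + |ψ₂|²)`.
Functions on `Ω ⊆ ℂ` are represented by functions on `ℂ` whose values off `Ω` play no role. -/
abbrev Spinor : Type := ℂ → EuclideanSpace ℂ (Fin 2)

/-- `f ∈ L^r_loc(Ω)`: `f` is in `L^r` on every compact subset of the open set `Ω`. -/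
def MemLpLoc {F : Type*} [NormedAddCommGroup F] (f : ℂ → F) (r : ℝ≥0∞) (Ω : Opens ℂ) : Prop :=
  ∀ K : Set ℂ, IsCompact K → K ⊆ (Ω : Set ℂ) → MemLp f r (volume.restrict K)

/-- `g` is the derivative of `f` on `Ω` in the direction `v` in the sense of distributions;
`f` and `g` are meant to be locally integrable on `Ω`. -/
def IsWeakDeriv {F : Type*} [NormedAddCommGroup F] [NormedSpace ℝ F]
    (Ω : Opens ℂ) (v : ℂ) (f g : ℂ → F) : Prop :=
  ∀ φ : 𝓓(Ω, ℝ),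
    ∫ z in (Ω : Set ℂ), (fderiv ℝ φ z v) • f z = - ∫ z in (Ω : Set ℂ), φ z • g z

/-- `f ∈ W^{1,r}_loc(Ω)`: `f` and its weak partial derivatives with respect to the real
coordinates `x`, `y` of `z = x + i y` are in `L^r_loc(Ω)`. -/
def MemSobolevLoc {F : Type*} [NormedAddCommGroup F] [NormedSpace ℝ F]
    (f : ℂ → F) (r : ℝ≥0∞) (Ω : Opens ℂ) : Prop :=
  MemLpLoc f r Ω ∧ ∃ fx fy : ℂ → F,
    MemLpLoc fx r Ω ∧ MemLpLoc fy r Ω ∧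
    IsWeakDeriv Ω 1 f fx ∧ IsWeakDeriv Ω Complex.I f fy

/-- The operator `!![∂̄, -conj U; U, ∂]`, with `∂̄ = (∂_x + i ∂_y) / 2` and
`∂ = (∂_x - i ∂_y) / 2`, evaluated on a spinor `ψ` with partial derivatives `ψx`, `ψy`. -/
noncomputable def holStructure (U : ℂ → ℂ) (ψ ψx ψy : Spinor) : Spinor := fun z =>
  !₂[(ψx z 0 + Complex.I * ψy z 0) / 2 - conj (U z) * ψ z 1,
     U z * ψ z 0 + (ψx z 1 - Complex.I * ψy z 1) / 2]

/-- `ψ` lies on `Ω` in the kernel of the holomorphic structure with potential `U`: it has locally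
integrable weak partial derivatives, and the operator maps it to zero
(almost everywhere on `Ω`). -/
def InKernel (Ω : Opens ℂ) (U : ℂ → ℂ) (ψ : Spinor) : Prop :=
  MemLpLoc ψ 1 Ω ∧ ∃ ψx ψy : Spinor,
    MemLpLoc ψx 1 Ω ∧ MemLpLoc ψy 1 Ω ∧
    IsWeakDeriv Ω 1 ψ ψx ∧ IsWeakDeriv Ω Complex.I ψ ψy ∧
    ∀ᵐ z ∂(volume.restrict (Ω : Set ℂ)), holStructure U ψ ψx ψy z = 0

/-! Put v₁ = ψ₁ and v₂ = conj ψ₂. Conjugation turns ∂ into ∂̄, so |∂̄v₁| ≤ |U| |v₂| and |∂̄v₂| ≤ |U|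
|v₁|, and only these inequalities matter. With q = 2p/(2-p), so that 1/p = 1/2 + 1/q, the argument
is a Carleman estimate with holomorphic weights.

A compactly supported function is the Cauchy integral of its ∂̄-derivative, and convolution with
|z|⁻¹ maps L^p to L^q (Hardy–Littlewood–Sobolev, `exists_eLpNorm_rieszPotential_le`). Hence ‖φf‖_q ≤
C(‖φ ∂̄f‖_p + ‖(∂̄φ) f‖_p) for every cutoff φ (`exists_eLpNorm_mul_le`). Take φ to be (z-c)⁻ⁿ times
a cutoff to an annulus around c (`exists_weighted_cutoff`). The weight is holomorphic away from c,
so ∂̄ falls on the cutoff alone, and C does not depend on n. By Hölder, ‖φ ∂̄v₁‖_p ≤ ‖U‖₂ ‖φv₂‖_q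
and symmetrically; where C‖U‖₂ ≤ 1/2 these terms are absorbed. What remains is an inner term, which
tends to zero with the inner radius thanks to the infinite-order decay, and an outer term of size
r⁻ⁿ⁻¹. Within radius r/2 the weight is at least (r/2)⁻ⁿ, so the L^q norm there is O(2⁻ⁿ), hence zero
(`exists_ae_eq_zero_of_vanishesToInfiniteOrder`).

The radius is constrained only by Ω and by the smallness of ‖U‖₂, hence can be chosen uniformly for
centres near a given point of Ω. The set of points around which v vanishes is therefore open and
relatively closed in Ω, and connectedness concludes. -/

/-! ### Integrals of powers of the kernel |z|⁻¹. -/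

/-- Polar coordinates for the integral of a radial function on the plane. -/
theorem lintegral_fun_norm_complex {F : ℝ → ℝ≥0∞} (hF : Measurable F) :
    ∫⁻ z : ℂ, F ‖z‖ = ENNReal.ofReal (2 * Real.pi) *
      ∫⁻ r in Set.Ioi (0 : ℝ), ENNReal.ofReal r * F r := by
  rw [← Complex.lintegral_comp_polarCoord_symm]
  have h1 : ∀ p ∈ polarCoord.target, ENNReal.ofReal p.1 • F ‖Complex.polarCoord.symm p‖
      = ENNReal.ofReal p.1 * F p.1 := by
    intro p hp
    rw [Complex.norm_polarCoord_symm, abs_of_pos hp.1, smul_eq_mul]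
  rw [setLIntegral_congr_fun polarCoord.open_target.measurableSet h1, polarCoord_target,
    Measure.volume_eq_prod, ← Measure.prod_restrict, lintegral_prod]
  · simp only [lintegral_const, Measure.restrict_apply MeasurableSet.univ, Set.univ_inter,
      Real.volume_Ioo]
    rw [lintegral_mul_const _ (by fun_prop), mul_comm]
    congr 2
    ring
  · fun_prop

theorem lintegral_ball_enorm_inv_le (R : ℝ) :
    ∫⁻ z : ℂ, (ball (0 : ℂ) R).indicator (fun w => ‖w‖ₑ⁻¹) z ≤ ENNReal.ofReal (2 * Real.pi * R) := by
  have h1 : ∀ z : ℂ, (ball (0 : ℂ) R).indicator (fun w => ‖w‖ₑ⁻¹) z =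
      (fun r : ℝ => (Set.Iio R).indicator (fun r => (ENNReal.ofReal r)⁻¹) r) ‖z‖ := by
    intro z
    by_cases hz : ‖z‖ < R
    · simp [Set.indicator, hz]
    · simp [Set.indicator, hz]
  simp_rw [h1]
  rw [lintegral_fun_norm_complex]
  · rw [ENNReal.ofReal_mul (show (0 : ℝ) ≤ 2 * Real.pi by positivity)]
    gcongr
    calc _ ≤ ∫⁻ r in Set.Ioi (0 : ℝ), (Set.Iio R).indicator 1 r := by
          apply lintegral_mono
          intro r
          by_cases hr : r < R
          · simp only [Set.indicator, Set.mem_Iio, hr, if_true, Pi.one_apply]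
            exact ENNReal.mul_inv_le_one _
          · simp [Set.indicator, hr]
      _ = _ := by
          rw [lintegral_indicator_one measurableSet_Iio, Measure.restrict_apply measurableSet_Iio,
            Set.inter_comm, Set.Ioi_inter_Iio, Real.volume_Ioo, sub_zero]
  · exact Measurable.indicator (by fun_prop) measurableSet_Iio

theorem lintegral_compl_ball_enorm_inv_rpow {R b : ℝ} (hR : 0 < R) (hb : 2 < b) :
    ∫⁻ z : ℂ, ((ball (0 : ℂ) R)ᶜ.indicator (fun w => ‖w‖ₑ⁻¹) z) ^ b =
      ENNReal.ofReal (2 * Real.pi / (b - 2) * R ^ (2 - b)) := by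
  have h1 : ∀ z : ℂ, ((ball (0 : ℂ) R)ᶜ.indicator (fun w => ‖w‖ₑ⁻¹) z) ^ b =
      (fun r : ℝ => (Set.Ici R).indicator (fun r => (ENNReal.ofReal r)⁻¹ ^ b) r) ‖z‖ := by
    intro z
    by_cases hz : R ≤ ‖z‖
    · simp [Set.indicator, hz]
    · simp only [Set.indicator, Set.mem_compl_iff, mem_ball, dist_zero_right, Set.mem_Ici, hz]
      simp [not_le.1 hz, show 0 < b by linarith]
  simp_rw [h1]
  rw [lintegral_fun_norm_complex]
  · have h2 : ∫⁻ r in Set.Ioi (0 : ℝ), ENNReal.ofReal r *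
        (Set.Ici R).indicator (fun r => (ENNReal.ofReal r)⁻¹ ^ b) r =
        ∫⁻ r in Set.Ioi R, ENNReal.ofReal (r ^ (1 - b)) := by
      have : ∀ r : ℝ, ENNReal.ofReal r *
        (Set.Ici R).indicator (fun r => (ENNReal.ofReal r)⁻¹ ^ b) r =
        (Set.Ici R).indicator (fun r => ENNReal.ofReal (r ^ (1 - b))) r := by
        intro r
        by_cases hr : R ≤ r
        · have h0 : 0 < r := by linarith
          simp only [Set.indicator, Set.mem_Ici, hr, if_true]
          rw [← ENNReal.ofReal_inv_of_pos h0, ENNReal.ofReal_rpow_of_pos (by positivity),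
            ← ENNReal.ofReal_mul h0.le, Real.inv_rpow h0.le, Real.rpow_sub h0, Real.rpow_one,
            div_eq_mul_inv]
        · simp [Set.indicator, hr]
      simp_rw [this]
      rw [lintegral_indicator measurableSet_Ici, Measure.restrict_restrict measurableSet_Ici,
        Set.inter_eq_left.2 (Set.Ici_subset_Ioi.2 hR)]
      exact setLIntegral_congr Ioi_ae_eq_Ici.symm
    rw [h2, ← ofReal_integral_eq_lintegral_ofReal, integral_Ioi_rpow_of_lt (by linarith) hR,
      ← ENNReal.ofReal_mul (by positivity)]
    · congr 1
      have : b - 2 ≠ 0 := by linarith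
      have h3 : 1 - b + 1 = -(b - 2) := by ring
      rw [h3, neg_div_neg_eq]
      rw [show -(b-2) = 2 - b by ring]
      field_simp
    · exact integrableOn_Ioi_rpow_of_lt (by linarith) hR
    · filter_upwards [ae_restrict_mem measurableSet_Ioi] with r hr
      have : 0 < r := lt_trans hR hr
      positivity
  · exact Measurable.indicator (by fun_prop) measurableSet_Ici

/-! ### The Riesz potential and the Hardy–Littlewood–Sobolev inequality. -/

/-- The Riesz potential of order one on the plane, up to normalization. -/
noncomputable def rieszPotential (f : ℂ → ℝ≥0∞) (z : ℂ) : ℝ≥0∞ :=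
  ∫⁻ w, f w * ‖z - w‖ₑ⁻¹

theorem measurable_rieszPotential {f : ℂ → ℝ≥0∞} (hf : Measurable f) :
    Measurable (rieszPotential f) := by
  unfold rieszPotential
  apply Measurable.lintegral_prod_right'
    (f := fun x : ℂ × ℂ => f x.2 * ‖x.1 - x.2‖ₑ⁻¹)
  fun_prop

theorem rieszPotential_congr_ae {f g : ℂ → ℝ≥0∞} (h : f =ᵐ[volume] g) :
    rieszPotential f = rieszPotential g := by
  ext z
  apply lintegral_congr_ae
  filter_upwards [h] with w hw
  rw [hw]

theorem rieszPotential_const_mul {f : ℂ → ℝ≥0∞} (hf : Measurable f) (c : ℝ≥0∞) (z : ℂ) :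
    rieszPotential (fun w => c * f w) z = c * rieszPotential f z := by
  unfold rieszPotential
  rw [← lintegral_const_mul _ (by fun_prop)]
  simp_rw [mul_assoc]

/-- Hölder's inequality: the dual exponent b of p exceeds 2, so |z|⁻ᵇ is integrable at infinity, and
the bound decays in R because 2/b < 1. -/
theorem lintegral_mul_compl_ball_le {f : ℂ → ℝ≥0∞} (hf : Measurable f) {p b : ℝ}
    (hpb : p.HolderConjugate b) (hb : 2 < b) (hfp : ∫⁻ z, f z ^ p ≤ 1) {R : ℝ} (hR : 0 < R) (z : ℂ) :
    ∫⁻ w, f w * (ball (0 : ℂ) R)ᶜ.indicator (fun w => ‖w‖ₑ⁻¹) (z - w) ≤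
      ENNReal.ofReal ((2 * Real.pi / (b - 2)) ^ (1 / b) * R ^ (2 / b - 1)) := by
  have hk : Measurable ((ball (0 : ℂ) R)ᶜ.indicator (fun w : ℂ => ‖w‖ₑ⁻¹)) :=
    Measurable.indicator (by fun_prop) measurableSet_ball.compl
  refine (ENNReal.lintegral_mul_le_Lp_mul_Lq volume hpb hf.aemeasurable
    (g := fun w => (ball (0 : ℂ) R)ᶜ.indicator (fun w => ‖w‖ₑ⁻¹) (z - w))
    (hk.comp (by fun_prop)).aemeasurable).trans ?_
  have h2 : ∫⁻ w, ((ball (0 : ℂ) R)ᶜ.indicator (fun w => ‖w‖ₑ⁻¹) (z - w)) ^ b =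
      ENNReal.ofReal (2 * Real.pi / (b - 2) * R ^ (2 - b)) := by
    rw [← lintegral_compl_ball_enorm_inv_rpow hR hb]
    exact lintegral_sub_left_eq_self
      (fun w => ((ball (0 : ℂ) R)ᶜ.indicator (fun w => ‖w‖ₑ⁻¹) w) ^ b) z
  have hb2 : 0 < b - 2 := by linarith
  rw [h2, ENNReal.ofReal_rpow_of_nonneg (by positivity) (by positivity)]
  refine (mul_le_of_le_one_left' (ENNReal.rpow_le_one hfp (by have := hpb.pos; positivity))).trans
    (le_of_eq ?_)
  rw [Real.mul_rpow (by positivity) (by positivity), ← Real.rpow_mul hR.le]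
  congr 3
  field_simp

/-- The kernel is split at radius R and f at height t. The far kernel contributes at most l/4, and
so does the part of f below t against the near kernel. Where the potential exceeds l, the large
values of f against the near kernel must therefore give at least l/2, and Markov's inequality bounds
the volume of that set. -/
theorem volume_lt_rieszPotential_le {f : ℂ → ℝ≥0∞} (hf : Measurable f) {p b : ℝ}
    (hpb : p.HolderConjugate b) (hb : 2 < b) (hfp : ∫⁻ z, f z ^ p ≤ 1) {R t l : ℝ} (hR : 0 < R)
    (ht : 0 < t) (hl : 0 < l)
    (h1 : (2 * Real.pi / (b - 2)) ^ (1 / b) * R ^ (2 / b - 1) ≤ l / 4)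
    (h2 : 2 * Real.pi * R * t ≤ l / 4) :
    volume {z | ENNReal.ofReal l < rieszPotential f z} ≤
      ENNReal.ofReal (4 * Real.pi * R / l) *
        ∫⁻ w, {w | ENNReal.ofReal t < f w}.indicator f w := by
  set k : ℂ → ℝ≥0∞ := (ball (0 : ℂ) R).indicator (fun w => ‖w‖ₑ⁻¹) with hkdef
  set k' : ℂ → ℝ≥0∞ := (ball (0 : ℂ) R)ᶜ.indicator (fun w => ‖w‖ₑ⁻¹) with hkdef'
  have hk : Measurable k := Measurable.indicator (by fun_prop) measurableSet_ball
  have hk' : Measurable k' := Measurable.indicator (by fun_prop) measurableSet_ball.compl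
  set F : ℂ → ℝ≥0∞ := {w | ENNReal.ofReal t < f w}.indicator f with hF
  have hFm : Measurable F := hf.indicator (measurableSet_lt measurable_const hf)
  have hnear : ∀ z, ∫⁻ w, k (z - w) ≤ ENNReal.ofReal (2 * Real.pi * R) := by
    intro z
    rw [lintegral_sub_left_eq_self k z]
    exact lintegral_ball_enorm_inv_le R
  have hnear' : ∀ w, ∫⁻ z, k (z - w) ≤ ENNReal.ofReal (2 * Real.pi * R) := by
    intro w
    rw [lintegral_sub_right_eq_self k w]
    exact lintegral_ball_enorm_inv_le R
  have hkz : ∀ z, Measurable fun w => k (z - w) := fun z => hk.comp (by fun_prop)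
  have hkz' : ∀ z, Measurable fun w => k' (z - w) := fun z => hk'.comp (by fun_prop)
  have hpt : ∀ z, rieszPotential f z ≤ ENNReal.ofReal (l / 2) + ∫⁻ w, F w * k (z - w) := by
    intro z
    have e1 : rieszPotential f z ≤ ∫⁻ w, (f w * k' (z - w) +
        (ENNReal.ofReal t * k (z - w) + F w * k (z - w))) := by
      apply lintegral_mono
      intro w
      have : ‖z - w‖ₑ⁻¹ = k' (z - w) + k (z - w) := by
        rw [hkdef, hkdef', Set.indicator_compl_add_self_apply]
      simp only [this, mul_add, ← add_mul]
      gcongr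
      by_cases hw : ENNReal.ofReal t < f w
      · have : F w = f w := by simp [hF, hw]
        rw [this]; exact le_add_self
      · exact (not_lt.1 hw).trans le_self_add
    refine e1.trans ?_
    rw [lintegral_add_left (by have := hkz' z; fun_prop),
      lintegral_add_left (by have := hkz z; fun_prop), lintegral_const_mul _ (hkz z), ← add_assoc]
    gcongr
    calc _ ≤ ENNReal.ofReal (l / 4) + ENNReal.ofReal t * ENNReal.ofReal (2 * Real.pi * R) := by
          gcongr
          · exact (lintegral_mul_compl_ball_le hf hpb hb hfp hR z).trans
              (ENNReal.ofReal_le_ofReal h1)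
          · exact hnear z
      _ ≤ ENNReal.ofReal (l / 4) + ENNReal.ofReal (l / 4) := by
          rw [← ENNReal.ofReal_mul ht.le]
          gcongr
          linarith
      _ = _ := by
          rw [← ENNReal.ofReal_add (by positivity) (by positivity)]
          congr 1; ring
  have hFk : Measurable fun x : ℂ × ℂ => F x.2 * k (x.1 - x.2) :=
    (hFm.comp measurable_snd).mul (hk.comp (by fun_prop))
  have hG : Measurable fun z => ∫⁻ w, F w * k (z - w) := Measurable.lintegral_prod_right' hFk
  calc volume {z | ENNReal.ofReal l < rieszPotential f z}
      ≤ volume {z | ENNReal.ofReal (l / 2) ≤ ∫⁻ w, F w * k (z - w)} := by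
        apply measure_mono
        intro z hz
        by_contra hc
        simp only [Set.mem_ofPred_eq, not_le] at hz hc
        have := hz.trans_le (hpt z)
        have h3 : ENNReal.ofReal (l / 2) + ∫⁻ w, F w * k (z - w) <
            ENNReal.ofReal (l / 2) + ENNReal.ofReal (l / 2) :=
          ENNReal.add_lt_add_left ENNReal.ofReal_ne_top hc
        rw [← ENNReal.ofReal_add (by positivity) (by positivity), add_halves] at h3
        exact lt_irrefl _ (this.trans h3)
    _ ≤ (∫⁻ z, ∫⁻ w, F w * k (z - w)) / ENNReal.ofReal (l / 2) :=
        meas_ge_le_lintegral_div hG.aemeasurable (by simpa using hl) ENNReal.ofReal_ne_top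
    _ ≤ (ENNReal.ofReal (2 * Real.pi * R) * ∫⁻ w, F w) / ENNReal.ofReal (l / 2) := by
        gcongr
        rw [lintegral_lintegral_swap hFk.aemeasurable, ← lintegral_const_mul _ hFm]
        apply lintegral_mono
        intro w
        simp only
        rw [lintegral_const_mul _ (show Measurable fun z => k (z - w) from hk.comp (by fun_prop)), mul_comm]
        gcongr
        exact hnear' w
    _ = _ := by
        rw [mul_comm, mul_div_assoc, ← ENNReal.ofReal_div_of_pos (by positivity), mul_comm]
        congr 2
        field_simp
        ring

/-- This is the inner integral left after Tonelli in the layer-cake argument. The set is 0 < l <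
(y/c)^(1/(1+s)), and s > 1 makes l^(s-2) integrable at zero. -/
theorem lintegral_indicator_rpow_le {s c y : ℝ} (hs : 1 < s) (hc : 0 < c) (hy : 0 ≤ y) :
    ∫⁻ l in Set.Ioi (0 : ℝ), {l : ℝ | c * l ^ (1 + s) < y}.indicator
      (fun l => ENNReal.ofReal (l ^ (s - 2))) l ≤
      ENNReal.ofReal ((y / c) ^ ((s - 1) / (s + 1)) / (s - 1)) := by
  set L := (y / c) ^ (1 / (1 + s)) with hL
  have hL0 : 0 ≤ L := by positivity
  have h1 : ∀ l ∈ Set.Ioi (0 : ℝ), {l : ℝ | c * l ^ (1 + s) < y}.indicator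
      (fun l => ENNReal.ofReal (l ^ (s - 2))) l ≤
      (Set.Ioc 0 L).indicator (fun l => ENNReal.ofReal (l ^ (s - 2))) l := by
    intro l hl
    have hl : 0 < l := hl
    by_cases h : c * l ^ (1 + s) < y
    · have hlL : l ≤ L := by
        rw [hL, one_div, Real.le_rpow_inv_iff_of_pos hl.le (by positivity) (by linarith)]
        rw [le_div_iff₀ hc]; linarith
      simp [Set.indicator, h, hl, hlL]
    · simp [Set.indicator, h]
  refine (setLIntegral_mono' measurableSet_Ioi h1).trans ?_
  refine (setLIntegral_le_lintegral _ _).trans ?_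
  rw [lintegral_indicator measurableSet_Ioc, ← ofReal_integral_eq_lintegral_ofReal,
    ← intervalIntegral.integral_of_le hL0, integral_rpow (Or.inl (by linarith))]
  · apply ENNReal.ofReal_le_ofReal
    rw [Real.zero_rpow (by linarith), sub_zero, hL, ← Real.rpow_mul (by positivity)]
    apply le_of_eq
    congr 1
    · congr 1
      field_simp
      ring
    · ring
  · have := (intervalIntegral.intervalIntegrable_rpow' (a := 0) (b := L) (r := s - 2) (by linarith))
    rwa [intervalIntegrable_iff_integrableOn_Ioc_of_le hL0] at this
  · filter_upwards [ae_restrict_mem measurableSet_Ioc] with r hr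
    have : 0 < r := hr.1
    positivity

/-- The free parameters are tuned to make both error terms exactly l/4: R proportional to l⁻ˢ for
the far kernel, then t = l/(8πR), proportional to l^(1+s). Here s = p/(2-p), so p = 2s/(s+1) and the
target exponent q is 2s. -/
theorem exists_volume_lt_rieszPotential_le {s : ℝ} (hs : 1 < s) : ∃ A c : ℝ, 0 < A ∧ 0 < c ∧
    ∀ f : ℂ → ℝ≥0∞, Measurable f → ∫⁻ z, f z ^ (2 * s / (s + 1)) ≤ 1 → ∀ l : ℝ, 0 < l →
      volume {z | ENNReal.ofReal l < rieszPotential f z} ≤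
        ENNReal.ofReal (A * l ^ (-1 - s)) *
          ∫⁻ w, {w | ENNReal.ofReal (c * l ^ (1 + s)) < f w}.indicator f w := by
  set b := 2 * s / (s - 1) with hb
  have hs1 : 0 < s - 1 := by linarith
  have hb2 : 2 < b := by rw [hb, lt_div_iff₀ hs1]; linarith
  have hpb : (2 * s / (s + 1)).HolderConjugate b := by
    rw [Real.holderConjugate_iff]
    constructor
    · rw [lt_div_iff₀ (by linarith)]; linarith
    · rw [hb]; field_simp; ring
  set K := (2 * Real.pi / (b - 2)) ^ (1 / b) with hK
  have hK0 : 0 < K := by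
    have : 0 < b - 2 := by linarith
    positivity
  set C₀ := (4 * K) ^ s with hC
  have hC0 : 0 < C₀ := by positivity
  refine ⟨4 * Real.pi * C₀, 1 / (8 * Real.pi * C₀), by positivity, by positivity, ?_⟩
  intro f hf hfp l hl
  have h := volume_lt_rieszPotential_le hf hpb hb2 hfp (R := C₀ * l ^ (-s))
    (t := 1 / (8 * Real.pi * C₀) * l ^ (1 + s)) (l := l) (by positivity) (by positivity) hl ?_ ?_
  · convert h using 3
    rw [Real.rpow_sub hl, Real.rpow_neg_one, Real.rpow_neg hl.le]
    field_simp
  · rw [← hK]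
    have e : 2 / b - 1 = - (1 / s) := by rw [hb]; field_simp; ring
    rw [e, Real.mul_rpow (by positivity) (by positivity), hC, ← Real.rpow_mul (by positivity),
      ← Real.rpow_mul hl.le]
    have e1 : s * -(1 / s) = -1 := by field_simp
    have e2 : -s * -(1 / s) = 1 := by field_simp
    rw [e1, e2, Real.rpow_neg_one, Real.rpow_one]
    apply le_of_eq
    field_simp
  · rw [Real.rpow_add hl, Real.rpow_one, Real.rpow_neg hl.le]
    apply le_of_eq
    field_simp
    ring

/-- Where f > t, the factor (f/t)^(p-1) is at least one. -/
theorem indicator_lt_le_rpow {p : ℝ} (hp : 1 < p) {t : ℝ} (ht : 0 < t) (f : ℂ → ℝ≥0∞) (w : ℂ) :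
    {w | ENNReal.ofReal t < f w}.indicator f w ≤ ENNReal.ofReal (t ^ (1 - p)) * f w ^ p := by
  by_cases h : ENNReal.ofReal t < f w
  · simp only [Set.indicator, Set.mem_ofPred_eq, h, if_true]
    rw [← ENNReal.ofReal_rpow_of_pos ht]
    calc f w = ENNReal.ofReal t ^ (1 - p) * (ENNReal.ofReal t ^ (p - 1) * f w) := by
          rw [← mul_assoc, ← ENNReal.rpow_add _ _ (by simpa using ht) ENNReal.ofReal_ne_top]
          simp
      _ ≤ ENNReal.ofReal t ^ (1 - p) * (f w ^ (p - 1) * f w) := by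
          gcongr
      _ = _ := by
          congr 1
          nth_rewrite 2 [← ENNReal.rpow_one (f w)]
          rw [← ENNReal.rpow_add_of_nonneg _ _ (by linarith) zero_le_one]
          simp
  · simp [Set.indicator, h]

/-- The set where the potential is infinite lies in every superlevel set, whose volume is
O(l^(-1-s)). Finiteness is needed because the layer-cake formula is applied to real values, and
`toReal` sends ∞ to 0. -/
theorem ae_rieszPotential_lt_top {s : ℝ} (hs : 1 < s) {f : ℂ → ℝ≥0∞} (hf : Measurable f)
    (hfp : ∫⁻ z, f z ^ (2 * s / (s + 1)) ≤ 1) : ∀ᵐ z, rieszPotential f z < ∞ := by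
  obtain ⟨A, c, hA, hc, H⟩ := exists_volume_lt_rieszPotential_le hs
  set p := 2 * s / (s + 1) with hp
  have hp1 : 1 < p := by rw [hp, lt_div_iff₀ (by linarith)]; linarith
  have h1 : ∀ l : ℝ, 1 ≤ l → volume {z | ¬ rieszPotential f z < ∞} ≤
      ENNReal.ofReal (A * l ^ (-1 - s) * c ^ (1 - p)) := by
    intro l hl
    have hl0 : 0 < l := by linarith
    calc _ ≤ volume {z | ENNReal.ofReal l < rieszPotential f z} := by
          apply measure_mono
          intro z hz
          simp only [Set.mem_ofPred_eq, not_lt, top_le_iff] at hz ⊢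
          rw [hz]; exact ENNReal.ofReal_lt_top
      _ ≤ _ := H f hf hfp l hl0
      _ ≤ ENNReal.ofReal (A * l ^ (-1 - s)) * ∫⁻ w, ENNReal.ofReal (c ^ (1 - p)) * f w ^ p := by
          gcongr with w
          refine le_trans ?_ (indicator_lt_le_rpow hp1 hc f w)
          apply Set.indicator_le_indicator_of_subset _ (fun _ => zero_le)
          intro w hw
          refine lt_of_le_of_lt (ENNReal.ofReal_le_ofReal ?_) hw
          exact le_mul_of_one_le_right hc.le (Real.one_le_rpow hl (by linarith))
      _ ≤ ENNReal.ofReal (A * l ^ (-1 - s)) * (ENNReal.ofReal (c ^ (1 - p)) * 1) := by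
          rw [lintegral_const_mul _ (by fun_prop)]
          gcongr
      _ = _ := by rw [mul_one, ← ENNReal.ofReal_mul (by positivity)]
  have h2 : Tendsto (fun l : ℝ => ENNReal.ofReal (A * l ^ (-1 - s) * c ^ (1 - p))) atTop (𝓝 0) := by
    have : Tendsto (fun l : ℝ => A * l ^ (-1 - s) * c ^ (1 - p)) atTop (𝓝 0) := by
      have := ((tendsto_rpow_neg_atTop (y := 1 + s) (by linarith)).const_mul A).mul_const (c ^ (1 - p))
      simp only [mul_zero, zero_mul] at this
      convert this using 4
      ring_nf
    simpa using ENNReal.tendsto_ofReal this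
  rw [ae_iff]
  refine le_antisymm (ge_of_tendsto h2 ?_) (zero_le)
  filter_upwards [eventually_ge_atTop 1] with l hl using h1 l hl

/-- Hardy–Littlewood–Sobolev inequality for normalized functions. -/
theorem exists_lintegral_rieszPotential_rpow_le_of_le_one {s : ℝ} (hs : 1 < s) :
    ∃ C : ℝ≥0∞, C ≠ ∞ ∧ ∀ f : ℂ → NNReal, Measurable f →
      ∫⁻ z, (f z : ℝ≥0∞) ^ (2 * s / (s + 1)) ≤ 1 →
      ∫⁻ z, rieszPotential (fun w => f w) z ^ (2 * s) ≤ C := by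
  obtain ⟨A, c, hA, hc, H⟩ := exists_volume_lt_rieszPotential_le hs
  set p := 2 * s / (s + 1) with hp
  have hs1 : 0 < s - 1 := by linarith
  set e := (s - 1) / (s + 1) with he
  have hep : 1 + e = p := by rw [he, hp]; field_simp; ring
  have he0 : 0 < e := by have : 0 < s + 1 := by linarith
                         positivity
  refine ⟨ENNReal.ofReal (2 * s) * (ENNReal.ofReal A * ENNReal.ofReal ((1 / c) ^ e / (s - 1))),
    by finiteness, ?_⟩
  intro f hf hfp
  have hf' : Measurable fun w => (f w : ℝ≥0∞) := by fun_prop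
  set G := rieszPotential (fun w => (f w : ℝ≥0∞)) with hG
  have hGm : Measurable G := measurable_rieszPotential hf'
  have hsm : MeasurableSet {x : ℝ × ℂ | c * x.1 ^ (1 + s) < (f x.2 : ℝ)} :=
    measurableSet_lt (by fun_prop) (by fun_prop)
  -- The powers combine as l^(-1-s) · l^(2s-1) = l^(s-2).
  have step : ∀ l ∈ Set.Ioi (0 : ℝ), volume {z | l < (G z).toReal} * ENNReal.ofReal (l ^ (2 * s - 1)) ≤
      ENNReal.ofReal A * ∫⁻ w, {x : ℝ × ℂ | c * x.1 ^ (1 + s) < (f x.2 : ℝ)}.indicator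
        (fun x => (f x.2 : ℝ≥0∞) * ENNReal.ofReal (x.1 ^ (s - 2))) (l, w) := by
    intro l hl
    have hl : 0 < l := hl
    calc _ ≤ volume {z | ENNReal.ofReal l < G z} * ENNReal.ofReal (l ^ (2 * s - 1)) := by
          gcongr with z
          intro h
          exact ((ENNReal.lt_ofReal_iff_toReal_lt (by simp)).2 (by simpa [hl.le] using h)).trans_le
            ENNReal.ofReal_toReal_le
      _ ≤ (ENNReal.ofReal (A * l ^ (-1 - s)) *
          ∫⁻ w, {w | ENNReal.ofReal (c * l ^ (1 + s)) < f w}.indicator (fun w => (f w : ℝ≥0∞)) w) *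
            ENNReal.ofReal (l ^ (2 * s - 1)) := by
          gcongr
          exact H _ hf' hfp l hl
      _ = _ := by
          rw [ENNReal.ofReal_mul hA.le, mul_assoc, mul_assoc]
          congr 1
          rw [← mul_comm, mul_assoc, mul_comm, ← ENNReal.ofReal_mul (by positivity),
            ← Real.rpow_add hl, mul_comm, ← lintegral_mul_const]
          · apply lintegral_congr
            intro w
            have : (ENNReal.ofReal (c * l ^ (1 + s)) < f w) ↔ c * l ^ (1 + s) < (f w : ℝ) := by
              rw [ENNReal.ofReal_lt_coe_iff (by positivity)]
            by_cases h : c * l ^ (1 + s) < (f w : ℝ)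
            · simp only [Set.indicator, Set.mem_ofPred_eq, this, h, if_true]
              congr 3
              ring
            · simp [Set.indicator, this, h]
          · exact hf'.indicator (measurableSet_lt measurable_const hf')
  have hfin : ∀ᵐ z, G z < ∞ := ae_rieszPotential_lt_top hs hf' hfp
  calc ∫⁻ z, G z ^ (2 * s) = ∫⁻ z, ENNReal.ofReal ((G z).toReal ^ (2 * s)) := by
        apply lintegral_congr_ae
        filter_upwards [hfin] with z hz
        rw [← ENNReal.ofReal_rpow_of_nonneg ENNReal.toReal_nonneg (by linarith),
          ENNReal.ofReal_toReal hz.ne]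
    _ = ENNReal.ofReal (2 * s) * ∫⁻ l in Set.Ioi (0 : ℝ), volume {z | l < (G z).toReal} *
          ENNReal.ofReal (l ^ (2 * s - 1)) :=
        lintegral_rpow_eq_lintegral_meas_lt_mul volume
          (Eventually.of_forall fun _ => ENNReal.toReal_nonneg) (by fun_prop) (by linarith)
    _ ≤ ENNReal.ofReal (2 * s) * ∫⁻ l in Set.Ioi (0 : ℝ), ENNReal.ofReal A * ∫⁻ w,
          {x : ℝ × ℂ | c * x.1 ^ (1 + s) < (f x.2 : ℝ)}.indicator
        (fun x => (f x.2 : ℝ≥0∞) * ENNReal.ofReal (x.1 ^ (s - 2))) (l, w) := by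
        refine mul_le_mul_right ?_ _
        exact setLIntegral_mono' measurableSet_Ioi step
    -- Tonelli: integrating in l first leaves f · f^((s-1)/(s+1)) = f^p up to a constant.
    _ = ENNReal.ofReal (2 * s) * (ENNReal.ofReal A * ∫⁻ w, ∫⁻ l in Set.Ioi (0 : ℝ),
          {x : ℝ × ℂ | c * x.1 ^ (1 + s) < (f x.2 : ℝ)}.indicator
        (fun x => (f x.2 : ℝ≥0∞) * ENNReal.ofReal (x.1 ^ (s - 2))) (l, w)) := by
        rw [lintegral_const_mul' _ _ (by finiteness), lintegral_lintegral_swap]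
        exact (Measurable.indicator (by fun_prop) hsm).aemeasurable
    _ ≤ ENNReal.ofReal (2 * s) * (ENNReal.ofReal A *
          ∫⁻ w, ENNReal.ofReal ((1 / c) ^ e / (s - 1)) * (f w : ℝ≥0∞) ^ p) := by
        gcongr with w
        have : ∀ l, {x : ℝ × ℂ | c * x.1 ^ (1 + s) < (f x.2 : ℝ)}.indicator
            (fun x => (f x.2 : ℝ≥0∞) * ENNReal.ofReal (x.1 ^ (s - 2))) (l, w) =
            (f w : ℝ≥0∞) * {l : ℝ | c * l ^ (1 + s) < f w}.indicator
              (fun l => ENNReal.ofReal (l ^ (s - 2))) l := by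
          intro l
          simp [Set.indicator]
        simp_rw [this]
        rw [lintegral_const_mul' _ _ (by finiteness)]
        calc _ ≤ (f w : ℝ≥0∞) * ENNReal.ofReal (((f w : ℝ) / c) ^ e / (s - 1)) := by
              gcongr
              exact lintegral_indicator_rpow_le hs hc (f w).coe_nonneg
          _ = _ := by
              rw [← ENNReal.ofReal_coe_nnreal, ENNReal.ofReal_rpow_of_nonneg (f w).coe_nonneg (show 0 ≤ p by linarith),
                ← ENNReal.ofReal_mul (f w).coe_nonneg, ← ENNReal.ofReal_mul (by positivity)]
              congr 1
              rw [← hep, Real.rpow_add_of_nonneg (f w).coe_nonneg zero_le_one he0.le, Real.rpow_one,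
                div_eq_mul_one_div (f w : ℝ) c, Real.mul_rpow (f w).coe_nonneg (by positivity)]
              ring
    _ ≤ _ := by
        gcongr
        rw [lintegral_const_mul _ (by fun_prop)]
        exact mul_le_of_le_one_right' hfp

/-- **Hardy–Littlewood–Sobolev inequality** for the Riesz potential of order one on the plane. -/
theorem exists_eLpNorm_rieszPotential_le {p : ℝ} (hp1 : 1 < p) (hp2 : p < 2) :
    ∃ C : ℝ≥0∞, C ≠ ∞ ∧ ∀ g : ℂ → ℂ, AEStronglyMeasurable g →
      eLpNorm (rieszPotential fun w => ‖g w‖ₑ) (ENNReal.ofReal (2 * p / (2 - p))) volume ≤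
        C * eLpNorm g (ENNReal.ofReal p) volume := by
  have h2p : 0 < 2 - p := by linarith
  have hs : 1 < p / (2 - p) := by rw [lt_div_iff₀ h2p]; linarith
  obtain ⟨C, hC, H⟩ := exists_lintegral_rieszPotential_rpow_le_of_le_one hs
  have e1 : 2 * (p / (2 - p)) / (p / (2 - p) + 1) = p := by field_simp; ring
  rw [e1] at H
  set q := 2 * p / (2 - p) with hq
  have e2 : 2 * (p / (2 - p)) = q := by rw [hq]; ring
  rw [e2] at H
  have hq0 : 0 < q := by positivity
  have hp0 : 0 < p := by linarith
  -- The summand 1 keeps the constant nonzero, so that the bound is ∞ when the norm of g is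
  -- infinite.
  refine ⟨C ^ (1 / q) + 1, by finiteness, ?_⟩
  intro g hg
  wlog hgm : Measurable g generalizing g
  · have := this (hg.mk g) hg.stronglyMeasurable_mk.aestronglyMeasurable
      hg.stronglyMeasurable_mk.measurable
    rw [← eLpNorm_congr_ae hg.ae_eq_mk] at this
    convert this using 2
    apply rieszPotential_congr_ae
    filter_upwards [hg.ae_eq_mk] with w hw
    rw [← hw]
  set N := eLpNorm g (ENNReal.ofReal p) volume with hN
  have hNe : N ^ p = ∫⁻ w, ‖g w‖ₑ ^ p := by
    rw [hN, eLpNorm_eq_lintegral_rpow_enorm_toReal (by simpa using hp0) ENNReal.ofReal_ne_top,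
      ENNReal.toReal_ofReal hp0.le, ← ENNReal.rpow_mul, one_div, inv_mul_cancel₀ hp0.ne',
      ENNReal.rpow_one]
  rcases eq_or_ne N 0 with h0 | h0
  · have : g =ᵐ[volume] 0 := by
      rwa [hN, eLpNorm_eq_zero_iff hg (by simpa using hp0)] at h0
    have hz : (fun w => ‖g w‖ₑ) =ᵐ[volume] 0 := by
      filter_upwards [this] with w hw
      simp [hw]
    have hR : rieszPotential (fun w => ‖g w‖ₑ) = 0 := by
      rw [rieszPotential_congr_ae hz]
      ext z
      simp [rieszPotential]
    rw [hR]
    simp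
  rcases eq_or_ne N ∞ with hT | hT
  · rw [hT, ENNReal.mul_top (by simp)]
    exact le_top
  set n := N.toNNReal with hn
  have hnN : (n : ℝ≥0∞) = N := ENNReal.coe_toNNReal hT
  have hn0 : n ≠ 0 := by
    intro h; rw [h] at hnN; exact h0 (by simpa using hnN.symm)
  have hpt : ∀ w, ((n⁻¹ * ‖g w‖₊ : NNReal) : ℝ≥0∞) = N⁻¹ * ‖g w‖ₑ := by
    intro w
    rw [ENNReal.coe_mul, ENNReal.coe_inv hn0, hnN]
    rfl
  -- By homogeneity it suffices to treat g divided by its norm.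
  have key := H (fun w => n⁻¹ * ‖g w‖₊) (by fun_prop) ?_
  · simp_rw [hpt, rieszPotential_const_mul hgm.enorm] at key
    have hqe : eLpNorm (rieszPotential fun w => ‖g w‖ₑ) (ENNReal.ofReal q) volume =
        (∫⁻ z, (rieszPotential (fun w => ‖g w‖ₑ) z) ^ q) ^ (1 / q) := by
      rw [eLpNorm_eq_lintegral_rpow_enorm_toReal (by simpa using hq0) ENNReal.ofReal_ne_top,
        ENNReal.toReal_ofReal hq0.le]
      simp
    have h3 : ∀ z, rieszPotential (fun w => ‖g w‖ₑ) z ^ q =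
        N ^ q * (N⁻¹ * rieszPotential (fun w => ‖g w‖ₑ) z) ^ q := by
      intro z
      rw [← ENNReal.mul_rpow_of_nonneg _ _ hq0.le, ← mul_assoc, ENNReal.mul_inv_cancel h0 hT,
        one_mul]
    rw [hqe]
    simp_rw [h3]
    rw [lintegral_const_mul' _ _ (by finiteness), ENNReal.mul_rpow_of_nonneg _ _ (by positivity),
      ← ENNReal.rpow_mul, mul_one_div_cancel hq0.ne', ENNReal.rpow_one, mul_comm]
    gcongr
    exact (ENNReal.rpow_le_rpow key (by positivity)).trans le_self_add
  · simp_rw [hpt, ENNReal.mul_rpow_of_nonneg _ _ hp0.le]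
    rw [lintegral_const_mul' _ _ (by finiteness), ← hNe, ← ENNReal.mul_rpow_of_nonneg _ _ hp0.le,
      ENNReal.inv_mul_cancel h0 hT, ENNReal.one_rpow]

/-! ### The operator ∂̄, the Cauchy–Pompeiu formula and the Cauchy transform. -/

/-- The Wirtinger derivative `∂̄ = (∂_x + i ∂_y) / 2`. -/
noncomputable def dbar (f : ℂ → ℂ) (z : ℂ) : ℂ :=
  (fderiv ℝ f z 1 + Complex.I * fderiv ℝ f z Complex.I) / 2

theorem dbar_mul {f g : ℂ → ℂ} {z : ℂ} (hf : DifferentiableAt ℝ f z)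
    (hg : DifferentiableAt ℝ g z) : dbar (fun w => f w * g w) z = dbar f z * g z + f z * dbar g z := by
  unfold dbar
  rw [fderiv_fun_mul hf hg]
  simp
  ring

theorem dbar_sub {f g : ℂ → ℂ} {z : ℂ} (hf : DifferentiableAt ℝ f z)
    (hg : DifferentiableAt ℝ g z) : dbar (fun w => f w - g w) z = dbar f z - dbar g z := by
  unfold dbar
  rw [fderiv_fun_sub hf hg]
  simp
  ring

theorem dbar_eq_zero_of_differentiableAt {f : ℂ → ℂ} {z : ℂ} (hf : DifferentiableAt ℂ f z) :
    dbar f z = 0 := by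
  have h : fderiv ℝ f z = (fderiv ℂ f z).restrictScalars ℝ :=
    (hf.hasFDerivAt.restrictScalars ℝ).fderiv
  have h2 : fderiv ℂ f z Complex.I = Complex.I * fderiv ℂ f z 1 := by
    rw [← smul_eq_mul, ← map_smul, smul_eq_mul, mul_one]
  unfold dbar
  rw [h, ContinuousLinearMap.coe_restrictScalars', h2, ← mul_assoc, Complex.I_mul_I]
  ring

theorem Filter.EventuallyEq.dbar_eq {f g : ℂ → ℂ} {z : ℂ} (h : f =ᶠ[𝓝 z] g) :
    dbar f z = dbar g z := by
  unfold dbar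
  rw [h.fderiv_eq]

theorem dbar_comp_const_sub {h : ℂ → ℂ} {z w : ℂ} (hh : DifferentiableAt ℝ h (z - w)) :
    dbar (fun v => h (z - v)) w = - dbar h (z - w) := by
  have : HasFDerivAt (fun v => h (z - v)) ((fderiv ℝ h (z - w)).comp (-ContinuousLinearMap.id ℝ ℂ)) w :=
    hh.hasFDerivAt.comp w ((hasFDerivAt_id w).const_sub z)
  unfold dbar
  rw [this.fderiv]
  simp
  ring

theorem continuous_dbar {f : ℂ → ℂ} (hf : ContDiff ℝ 1 f) : Continuous (dbar f) := by
  have := hf.continuous_fderiv one_ne_zero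
  unfold dbar
  fun_prop

theorem tsupport_dbar_subset (f : ℂ → ℂ) : tsupport (dbar f) ⊆ tsupport f := by
  refine closure_minimal (fun z hz => ?_) (isClosed_tsupport f)
  by_contra h
  apply hz
  simp [dbar, image_eq_zero_of_notMem_tsupport (fun h' => h (tsupport_fderiv_subset ℝ h'))]

theorem HasCompactSupport.dbar {f : ℂ → ℂ} (hf : HasCompactSupport f) :
    HasCompactSupport (dbar f) :=
  IsCompact.of_isClosed_subset hf (isClosed_tsupport _) (tsupport_dbar_subset f)

theorem norm_cos_add_sin_mul_I (t : ℝ) : ‖(Real.cos t + Real.sin t * Complex.I : ℂ)‖ = 1 := by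
  rw [Complex.ofReal_cos, Complex.ofReal_sin, Complex.norm_cos_add_sin_mul_I]

theorem integral_radial_fderiv {h : ℂ → ℂ} (hh : ContDiff ℝ 1 h) (hc : HasCompactSupport h)
    {e : ℂ} (he : ‖e‖ = 1) :
    ∫ r in Set.Ioi (0 : ℝ), fderiv ℝ h (r * e) e = - h 0 := by
  have e0 : e ≠ 0 := by rintro rfl; simp at he
  have hd : ∀ r : ℝ, HasDerivAt (fun r : ℝ => h (r * e)) (fderiv ℝ h (r * e) e) r := by
    intro r
    have h1 : HasDerivAt (fun r : ℝ => (r : ℂ) * e) e r := by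
      simpa using (Complex.ofRealCLM.hasDerivAt (x := r)).mul_const e
    exact ((hh.differentiable one_ne_zero) _).hasFDerivAt.comp_hasDerivAt r h1
  have hcs : HasCompactSupport (fun r : ℝ => h (r * e)) := by
    obtain ⟨M, hM⟩ := hc.isCompact.isBounded.subset_closedBall 0
    refine HasCompactSupport.intro (isCompact_closedBall (0 : ℝ) M) fun r hr => ?_
    apply image_eq_zero_of_notMem_tsupport
    intro h'
    apply hr
    have := hM h'
    simpa [he] using this
  have hsm : ContDiff ℝ 1 (fun r : ℝ => h (r * e)) := by
    refine hh.comp ?_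
    exact Complex.ofRealCLM.contDiff.mul contDiff_const
  have := hcs.integral_Ioi_deriv_eq hsm 0
  simp_rw [fun r => (hd r).deriv] at this
  simpa using this

/-- The integrand times r is the derivative of a 2π-periodic function of the angle. -/
theorem integral_angular_fderiv {h : ℂ → ℂ} (hh : ContDiff ℝ 1 h) {r : ℝ} (hr : r ≠ 0) :
    ∫ t in Set.Ioo (-Real.pi) Real.pi, fderiv ℝ h (r * (Real.cos t + Real.sin t * Complex.I))
      (Complex.I * (Real.cos t + Real.sin t * Complex.I)) = 0 := by
  have hd : ∀ t : ℝ, HasDerivAt (fun t : ℝ => h (r * (Real.cos t + Real.sin t * Complex.I)))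
      (r • fderiv ℝ h (r * (Real.cos t + Real.sin t * Complex.I))
        (Complex.I * (Real.cos t + Real.sin t * Complex.I))) t := by
    intro t
    have h1 : HasDerivAt (fun t : ℝ => (r : ℂ) * (Real.cos t + Real.sin t * Complex.I))
        (r • (Complex.I * (Real.cos t + Real.sin t * Complex.I))) t := by
      have := (((Real.hasDerivAt_cos t).ofReal_comp.add
        ((Real.hasDerivAt_sin t).ofReal_comp.mul_const Complex.I)).const_mul (r : ℂ))
      refine this.congr_deriv ?_
      rw [Complex.real_smul, Complex.ofReal_neg]
      linear_combination (-(r : ℂ) * Real.sin t) * Complex.I_mul_I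
    have := ((hh.differentiable one_ne_zero) _).hasFDerivAt.comp_hasDerivAt t h1
    rwa [map_smul] at this
  have hcont : Continuous fun t : ℝ => fderiv ℝ h (r * (Real.cos t + Real.sin t * Complex.I))
      (Complex.I * (Real.cos t + Real.sin t * Complex.I)) := by
    have := hh.continuous_fderiv one_ne_zero
    refine Continuous.clm_apply (this.comp ?_) ?_ <;> fun_prop
  have hle : -Real.pi ≤ Real.pi := by have := Real.pi_pos; linarith
  have key := intervalIntegral.integral_eq_sub_of_hasDerivAt (a := -Real.pi) (b := Real.pi)
    (fun t _ => hd t) ((hcont.const_smul r).intervalIntegrable _ _)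
  rw [intervalIntegral.integral_smul] at key
  simp only [Real.cos_pi, Real.sin_pi, Real.cos_neg, Real.sin_neg, neg_zero, sub_self,
    smul_eq_zero, hr, false_or] at key
  rwa [intervalIntegral.integral_of_le hle, integral_Ioc_eq_integral_Ioo] at key

/-- **Cauchy–Pompeiu formula** for compactly supported functions. -/
theorem integral_inv_mul_dbar {h : ℂ → ℂ} (hh : ContDiff ℝ 1 h) (hc : HasCompactSupport h) :
    ∫ w, w⁻¹ * dbar h w = - Real.pi * h 0 := by
  set E : ℝ → ℂ := fun t => Real.cos t + Real.sin t * Complex.I with hE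
  have hEc : Continuous E := by fun_prop
  set D₁ : ℝ × ℝ → ℂ := fun x => fderiv ℝ h (x.1 * E x.2) (E x.2) with hD₁
  set D₂ : ℝ × ℝ → ℂ := fun x => fderiv ℝ h (x.1 * E x.2) (Complex.I * E x.2) with hD₂
  have hfd := hh.continuous_fderiv one_ne_zero
  have c₁ : Continuous D₁ := Continuous.clm_apply (hfd.comp (by fun_prop)) (by fun_prop)
  have c₂ : Continuous D₂ := Continuous.clm_apply (hfd.comp (by fun_prop)) (by fun_prop)
  obtain ⟨M, hM⟩ := hc.isCompact.isBounded.subset_closedBall 0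
  have hz : ∀ x : ℝ × ℝ, x.1 ∉ Set.Icc (-M) M → fderiv ℝ h (x.1 * E x.2) = 0 := by
    intro x hx
    apply image_eq_zero_of_notMem_tsupport
    intro h'
    apply hx
    have := hM (tsupport_fderiv_subset ℝ h')
    rw [mem_closedBall_zero_iff, norm_mul, norm_cos_add_sin_mul_I, mul_one, Complex.norm_real,
      Real.norm_eq_abs] at this
    exact abs_le.1 this
  have int : ∀ D : ℝ × ℝ → ℂ, Continuous D → (∀ x : ℝ × ℝ, x.1 ∉ Set.Icc (-M) M → D x = 0) →
      IntegrableOn D (Set.Ioi (0 : ℝ) ×ˢ Set.Ioo (-Real.pi) Real.pi)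
        ((volume : Measure ℝ).prod volume) := by
    intro D hD h0
    refine IntegrableOn.of_forall_sdiff_eq_zero
      (s := (Set.Icc (-M) M) ×ˢ Set.Icc (-Real.pi) Real.pi) ?_
      (measurableSet_Ioi.prod measurableSet_Ioo) ?_
    · exact hD.continuousOn.integrableOn_compact (isCompact_Icc.prod isCompact_Icc)
    · rintro x ⟨hx1, hx2⟩
      apply h0
      intro hx3
      exact hx2 ⟨hx3, Set.Ioo_subset_Icc_self hx1.2⟩
  have i₁ := int D₁ c₁ (fun x hx => by simp [hD₁, hz x hx])
  have i₂ := int D₂ c₂ (fun x hx => by simp [hD₂, hz x hx])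
  -- The Jacobian r cancels the modulus of w⁻¹. In the rotated frame E, iE, what is left is half of
  -- the radial derivative plus i times the angular one; the first integrates to -2π h(0), the
  -- second to zero.
  have hpt : ∀ x ∈ polarCoord.target, x.1 • ((Complex.polarCoord.symm x)⁻¹ *
      dbar h (Complex.polarCoord.symm x)) = (D₁ x + Complex.I * D₂ x) / 2 := by
    intro x hx
    have hx0 : (x.1 : ℂ) ≠ 0 := by
      have : 0 < x.1 := hx.1
      exact_mod_cast this.ne'
    have hE0 : E x.2 ≠ 0 := by
      intro h0
      have := norm_cos_add_sin_mul_I x.2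
      rw [show (Real.cos x.2 + Real.sin x.2 * Complex.I : ℂ) = 0 from h0] at this
      simp at this
    have hP : Complex.polarCoord.symm x = x.1 * E x.2 := by
      rw [Complex.polarCoord_symm_apply]
    have l₁ : D₁ x = Real.cos x.2 * fderiv ℝ h (x.1 * E x.2) 1 +
        Real.sin x.2 * fderiv ℝ h (x.1 * E x.2) Complex.I := by
      have : E x.2 = Real.cos x.2 • (1 : ℂ) + Real.sin x.2 • Complex.I := by simp [hE]
      simp only [hD₁]
      conv_lhs => rw [this, map_add, map_smul, map_smul, ← this]
      simp
    have l₂ : D₂ x = - Real.sin x.2 * fderiv ℝ h (x.1 * E x.2) 1 +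
        Real.cos x.2 * fderiv ℝ h (x.1 * E x.2) Complex.I := by
      have : Complex.I * E x.2 = (-Real.sin x.2) • (1 : ℂ) + Real.cos x.2 • Complex.I := by
        simp only [hE, Complex.real_smul, Complex.ofReal_neg, mul_one]
        linear_combination (Real.sin x.2 : ℂ) * Complex.I_mul_I
      simp only [hD₂]
      rw [this, map_add, map_smul, map_smul]
      simp
    have hinv : (E x.2)⁻¹ = Real.cos x.2 - Real.sin x.2 * Complex.I := by
      rw [inv_eq_iff_eq_inv, eq_comm, inv_eq_iff_eq_inv, eq_comm]
      apply inv_eq_of_mul_eq_one_left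
      simp only [hE]
      have := Real.cos_sq_add_sin_sq x.2
      have h2 : (Real.cos x.2 : ℂ) ^ 2 + (Real.sin x.2 : ℂ) ^ 2 = 1 := by exact_mod_cast this
      linear_combination h2 - (Real.sin x.2 : ℂ) ^ 2 * Complex.I_mul_I
    rw [hP, mul_inv, hinv, l₁, l₂, Complex.real_smul]
    unfold dbar
    field_simp
    linear_combination (-(Real.sin x.2 : ℂ) * fderiv ℝ h (x.1 * E x.2) Complex.I) * Complex.I_mul_I
  rw [← Complex.integral_comp_polarCoord_symm,
    setIntegral_congr_fun polarCoord.open_target.measurableSet hpt, integral_div, polarCoord_target,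
    Measure.volume_eq_prod, integral_add i₁ (i₂.const_mul _), integral_const_mul,
    setIntegral_prod _ i₂]
  have z₂ : ∫ r in Set.Ioi (0 : ℝ), ∫ t in Set.Ioo (-Real.pi) Real.pi, D₂ (r, t) = 0 := by
    rw [setIntegral_congr_fun (g := fun _ => (0 : ℂ)) measurableSet_Ioi]
    · simp
    · intro r hr
      exact integral_angular_fderiv hh (ne_of_gt hr)
  have z₁ : ∫ x in Set.Ioi (0 : ℝ) ×ˢ Set.Ioo (-Real.pi) Real.pi, D₁ x
      ∂((volume : Measure ℝ).prod volume) = - (2 * Real.pi) * h 0 := by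
    rw [← Measure.prod_restrict, integral_prod_symm _ (by rwa [Measure.prod_restrict])]
    have := fun t => integral_radial_fderiv hh hc (norm_cos_add_sin_mul_I t)
    simp only [hD₁, hE, this]
    rw [integral_const]
    simp [Real.pi_pos.le]
    left
    ring
  rw [z₂, z₁]
  ring

theorem locallyIntegrable_inv : LocallyIntegrable (fun w : ℂ => w⁻¹) := by
  intro x
  refine ⟨ball 0 (‖x‖ + 1), isOpen_ball.mem_nhds (by simp), ?_⟩
  refine ⟨(measurable_inv).aestronglyMeasurable, ?_⟩
  have h := lintegral_ball_enorm_inv_le (‖x‖ + 1)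
  rw [lintegral_indicator measurableSet_ball] at h
  refine lt_of_le_of_lt (le_trans ?_ h) ENNReal.ofReal_lt_top
  apply lintegral_mono
  intro w
  by_cases hw : w = 0
  · simp [hw]
  · exact (enorm_inv hw).le

/-- The Cauchy transform `z ↦ π⁻¹ ∫ w⁻¹ h (z - w)`, which is a right inverse of `∂̄`. -/
noncomputable def cauchyTransform (h : ℂ → ℂ) (z : ℂ) : ℂ :=
  (Real.pi : ℂ)⁻¹ * ∫ w, w⁻¹ * h (z - w)

theorem contDiff_cauchyTransform {h : ℂ → ℂ} (hh : ContDiff ℝ (⊤ : ℕ∞) h) (hc : HasCompactSupport h) :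
    ContDiff ℝ (⊤ : ℕ∞) (cauchyTransform h) := by
  have := hc.contDiff_convolution_right (ContinuousLinearMap.mul ℝ ℂ) locallyIntegrable_inv hh
    (μ := volume)
  exact contDiff_const.mul this

/-- Derivatives of the convolution fall on the smooth factor h, and Cauchy–Pompeiu is then applied
to w ↦ h (z - w); the reflection changes the sign of ∂̄. -/
theorem dbar_cauchyTransform {h : ℂ → ℂ} (hh : ContDiff ℝ 1 h) (hc : HasCompactSupport h) (z : ℂ) :
    dbar (cauchyTransform h) z = h z := by
  have h1 := (hc.hasFDerivAt_convolution_right (ContinuousLinearMap.mul ℝ ℂ) locallyIntegrable_inv hh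
    (μ := volume) z).const_mul (Real.pi : ℂ)⁻¹
  have hci : ConvolutionExists (fun w : ℂ => w⁻¹) (fderiv ℝ h)
      ((ContinuousLinearMap.mul ℝ ℂ).precompR ℂ) volume :=
    HasCompactSupport.convolutionExists_right _ (hc.fderiv ℝ) locallyIntegrable_inv
      (hh.continuous_fderiv one_ne_zero)
  have happ : ∀ v : ℂ, convolution (fun w : ℂ => w⁻¹) (fderiv ℝ h)
      ((ContinuousLinearMap.mul ℝ ℂ).precompR ℂ) volume z v = ∫ w, w⁻¹ * fderiv ℝ h (z - w) v := by
    intro v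
    rw [convolution, ContinuousLinearMap.integral_apply (hci z)]
    rfl
  have hint : ∀ v : ℂ, Integrable fun w => w⁻¹ * fderiv ℝ h (z - w) v := by
    intro v
    exact (ContinuousLinearMap.apply ℝ ℂ v).integrable_comp (hci z)
  have h2 : fderiv ℝ (cauchyTransform h) z = (Real.pi : ℂ)⁻¹ •
      convolution (fun w : ℂ => w⁻¹) (fderiv ℝ h) ((ContinuousLinearMap.mul ℝ ℂ).precompR ℂ)
        volume z := h1.fderiv
  have h3 := integral_inv_mul_dbar (h := fun w => h (z - w)) (hh.comp (contDiff_const.sub contDiff_id))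
    (hc.comp_homeomorph (Homeomorph.subLeft z))
  simp_rw [fun w => dbar_comp_const_sub (z := z) (w := w) ((hh.differentiable one_ne_zero) _)] at h3
  have hpi : (Real.pi : ℂ) ≠ 0 := by exact_mod_cast Real.pi_ne_zero
  rw [dbar, h2]
  simp only [smul_apply, happ, smul_eq_mul]
  have h4 : ∫ w, w⁻¹ * dbar h (z - w) = Real.pi * h z := by
    simp only [mul_neg, integral_neg, sub_zero, neg_mul, neg_inj] at h3
    exact h3
  have h5 : ∫ w, w⁻¹ * dbar h (z - w) = ((∫ w, w⁻¹ * fderiv ℝ h (z - w) 1) +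
      Complex.I * ∫ w, w⁻¹ * fderiv ℝ h (z - w) Complex.I) / 2 := by
    rw [← integral_const_mul, ← integral_add (hint 1) ((hint _).const_mul _), ← integral_div]
    congr 1
    ext w
    rw [dbar]
    ring
  rw [h5] at h4
  linear_combination (Real.pi : ℂ)⁻¹ * h4 + h z * inv_mul_cancel₀ hpi

/-! ### Cauchy representation of weak solutions and the Sobolev inequality for ∂̄. -/

theorem MemLpLoc.mono_exponent {F : Type*} [NormedAddCommGroup F] {f : ℂ → F} {p q : ℝ≥0∞}
    {Ω : Opens ℂ} (hf : MemLpLoc f q Ω) (hpq : p ≤ q) : MemLpLoc f p Ω := by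
  intro K hK hKΩ
  have : IsFiniteMeasure (volume.restrict K) := ⟨by simpa using hK.measure_lt_top⟩
  exact (hf K hK hKΩ).mono_exponent hpq

theorem MemLpLoc.continuous_smul {𝕜 F : Type*} [NontriviallyNormedField 𝕜] [NormedAddCommGroup F]
    [NormedSpace 𝕜 F] {g : ℂ → F} {φ : ℂ → 𝕜} {r : ℝ≥0∞} {Ω : Opens ℂ}
    (hg : MemLpLoc g r Ω) (hφ : Continuous φ) (hc : HasCompactSupport φ) (hs : tsupport φ ⊆ Ω) :
    MemLp (fun z => φ z • g z) r volume := by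
  have h := hg (tsupport φ) hc hs
  obtain ⟨M, hM⟩ := hφ.bounded_above_of_compact_support hc
  have h1 : MemLp (fun z => φ z • g z) r (volume.restrict (tsupport φ)) := by
    refine h.of_le_mul (c := M) (AEStronglyMeasurable.smul
      (hφ.stronglyMeasurable_of_hasCompactSupport hc).aestronglyMeasurable h.1)
      (Eventually.of_forall fun z => ?_)
    rw [norm_smul]
    gcongr
    exact hM z
  have h2 : (fun z => φ z • g z) = (tsupport φ).indicator (fun z => φ z • g z) := by
    ext z
    by_cases hz : z ∈ tsupport φ
    · simp [hz]
    · simp [hz, image_eq_zero_of_notMem_tsupport hz]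
  rw [h2, memLp_indicator_iff_restrict (isClosed_tsupport φ).measurableSet]
  exact h1

theorem MemLpLoc.continuous_mul {g φ : ℂ → ℂ} {r : ℝ≥0∞} {Ω : Opens ℂ} (hg : MemLpLoc g r Ω)
    (hφ : Continuous φ) (hc : HasCompactSupport φ) (hs : tsupport φ ⊆ Ω) :
    MemLp (fun z => φ z * g z) r volume :=
  hg.continuous_smul hφ hc hs

/-- By Tonelli it is enough to bound the integral of |z - w|⁻¹ over K uniformly in w: the kernel is
integrable near its pole and at most 1 elsewhere. This justifies the use of Fubini with the Cauchy
kernel. -/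
theorem setLIntegral_rieszPotential_lt_top {f : ℂ → ℝ≥0∞} (hf : AEMeasurable f)
    (hfi : ∫⁻ w, f w ≠ ∞) {K : Set ℂ} (hK : volume K ≠ ∞) :
    ∫⁻ z in K, rieszPotential f z < ∞ := by
  have hm : AEMeasurable (fun x : ℂ × ℂ => f x.2 * ‖x.1 - x.2‖ₑ⁻¹)
      ((volume.restrict K).prod volume) := by
    refine (hf.comp_quasiMeasurePreserving Measure.quasiMeasurePreserving_snd).mul ?_
    exact Measurable.aemeasurable (by fun_prop)
  have hb : ∀ w : ℂ, ∫⁻ z in K, ‖z - w‖ₑ⁻¹ ≤ ENNReal.ofReal (2 * Real.pi * 1) + volume K := by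
    intro w
    calc ∫⁻ z in K, ‖z - w‖ₑ⁻¹
        ≤ ∫⁻ z in K, ((ball (0 : ℂ) 1).indicator (fun v => ‖v‖ₑ⁻¹) (z - w) + 1) := by
          apply lintegral_mono
          intro z
          by_cases hz : ‖z - w‖ < 1
          · simp [Set.indicator, hz]
          · refine le_trans ?_ le_add_self
            rw [ENNReal.inv_le_one, ← ofReal_norm, ENNReal.one_le_ofReal]
            exact not_lt.1 hz
      _ = (∫⁻ z in K, (ball (0 : ℂ) 1).indicator (fun v => ‖v‖ₑ⁻¹) (z - w)) + volume K := by
          rw [lintegral_add_right _ measurable_const]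
          simp
      _ ≤ (∫⁻ z, (ball (0 : ℂ) 1).indicator (fun v => ‖v‖ₑ⁻¹) (z - w)) + volume K := by
          gcongr
          exact Measure.restrict_le_self
      _ ≤ _ := by
          rw [lintegral_sub_right_eq_self (fun z => (ball (0 : ℂ) 1).indicator (fun v => ‖v‖ₑ⁻¹) z)]
          gcongr
          exact lintegral_ball_enorm_inv_le 1
  unfold rieszPotential
  rw [lintegral_lintegral_swap hm]
  calc _ ≤ ∫⁻ w, f w * (ENNReal.ofReal (2 * Real.pi * 1) + volume K) := by
        apply lintegral_mono
        intro w
        simp only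
        rw [lintegral_const_mul _ (by fun_prop)]
        gcongr
        exact hb w
    _ < ∞ := by
        rw [lintegral_mul_const' _ _ (by finiteness)]
        exact ENNReal.mul_lt_top hfi.lt_top (by finiteness)

/-- `∂̄ f = g` on `Ω` in the sense of distributions. -/
def HasWeakDbar (Ω : Opens ℂ) (f g : ℂ → ℂ) : Prop :=
  ∀ φ : ℂ → ℂ, ContDiff ℝ (⊤ : ℕ∞) φ → HasCompactSupport φ → tsupport φ ⊆ Ω →
    ∫ z, dbar φ z * f z = - ∫ z, φ z * g z

/-- A compactly supported cutoff of `f` is the Cauchy integral of its `∂̄`-derivative. -/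
theorem HasWeakDbar.ae_eq_integral {Ω : Opens ℂ} {f g : ℂ → ℂ} (h : HasWeakDbar Ω f g)
    (hf : MemLpLoc f 1 Ω) (hg : MemLpLoc g 1 Ω) {φ : ℂ → ℂ} (hφ : ContDiff ℝ (⊤ : ℕ∞) φ)
    (hc : HasCompactSupport φ) (hs : tsupport φ ⊆ Ω) :
    ∀ᵐ z, φ z * f z =
      - ((Real.pi : ℂ)⁻¹ * ∫ w, (w - z)⁻¹ * (φ w * g w + dbar φ w * f w)) := by
  set G : ℂ → ℂ := fun w => φ w * g w + dbar φ w * f w with hG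
  have hφ1 : ContDiff ℝ 1 φ := hφ.of_le (by exact_mod_cast le_top)
  have hφf : MemLp (fun z => φ z * f z) 1 volume := hf.continuous_mul hφ.continuous hc hs
  have hGi : Integrable G := by
    rw [← memLp_one_iff_integrable]
    exact (hg.continuous_mul hφ.continuous hc hs).add
      (hf.continuous_mul (continuous_dbar hφ1) hc.dbar ((tsupport_dbar_subset φ).trans hs))
  set F : ℂ → ℂ := fun z => ∫ w, (w - z)⁻¹ * G w with hF
  have hFm : AEStronglyMeasurable F volume := by
    apply AEStronglyMeasurable.integral_prod_right' (f := fun x : ℂ × ℂ => (x.2 - x.1)⁻¹ * G x.2)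
    exact (Measurable.aestronglyMeasurable (by fun_prop)).mul
      (hGi.1.comp_quasiMeasurePreserving Measure.quasiMeasurePreserving_snd)
  have hGe : ∫⁻ w, ‖G w‖ₑ ≠ ∞ := hGi.2.ne
  have hen : ∀ z w : ℂ, ‖(w - z)⁻¹ * G w‖ₑ ≤ ‖G w‖ₑ * ‖z - w‖ₑ⁻¹ := by
    intro z w
    rw [enorm_mul, mul_comm]
    gcongr
    rcases eq_or_ne w z with rfl | hwz
    · simp
    · rw [enorm_inv (sub_ne_zero.2 hwz), ← enorm_neg, neg_sub]
  have hFb : ∀ z, ‖F z‖ₑ ≤ rieszPotential (fun w => ‖G w‖ₑ) z := by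
    intro z
    refine (enorm_integral_le_lintegral_enorm _).trans (lintegral_mono fun w => hen z w)
  have hFl : LocallyIntegrable F := by
    rw [locallyIntegrable_iff]
    intro K hK
    refine ⟨hFm.restrict, ?_⟩
    exact (lintegral_mono hFb).trans_lt
      (setLIntegral_rieszPotential_lt_top hGi.1.enorm hGe hK.measure_ne_top)
  have hFint : LocallyIntegrable (fun z => φ z * f z + (Real.pi : ℂ)⁻¹ * F z) :=
    (memLp_one_iff_integrable.1 hφf).locallyIntegrable.add (hFl.smul (Real.pi : ℂ)⁻¹)
  have key : ∀ᵐ z, φ z * f z + (Real.pi : ℂ)⁻¹ * F z = 0 := by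
    refine ae_eq_zero_of_integral_contDiff_smul_eq_zero hFint ?_
    intro k hk hkc
    set k' : ℂ → ℂ := fun z => (k z : ℂ) with hk'
    have hk's : ContDiff ℝ (⊤ : ℕ∞) k' := Complex.ofRealCLM.contDiff.comp hk
    have hk'c : HasCompactSupport k' := hkc.comp_left (g := fun x : ℝ => (x : ℂ)) (by simp)
    have hk'1 : ContDiff ℝ 1 k' := hk's.of_le (by exact_mod_cast le_top)
    -- The identity is tested against k = ∂̄u. The function u need not have compact support, but φu
    -- does, so it is admissible in the weak equation.
    set u := cauchyTransform k' with hu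
    have hus : ContDiff ℝ (⊤ : ℕ∞) u := contDiff_cauchyTransform hk's hk'c
    have hts : tsupport (fun z => φ z * u z) ⊆ tsupport φ := tsupport_mul_subset_left
    have e1 := h (fun z => φ z * u z) (hφ.mul hus) hc.mul_right (hts.trans hs)
    have hφd : Differentiable ℝ φ := hφ1.differentiable one_ne_zero
    have hud : Differentiable ℝ u := (hus.of_le (by exact_mod_cast le_top : (1 : WithTop ℕ∞) ≤ _)).differentiable one_ne_zero
    have e2 : ∀ z, dbar (fun z => φ z * u z) z = dbar φ z * u z + φ z * k' z := by
      intro z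
      rw [dbar_mul (hφd z) (hud z), hu, dbar_cauchyTransform hk'1 hk'c]
    have huc : Continuous u := hus.continuous
    have i1 : Integrable (fun z => φ z * u z * g z) := by
      rw [← memLp_one_iff_integrable]
      exact hg.continuous_mul (hφ.continuous.mul huc) hc.mul_right (hts.trans hs)
    have i2 : Integrable (fun z => dbar φ z * u z * f z) := by
      rw [← memLp_one_iff_integrable]
      exact hf.continuous_mul ((continuous_dbar hφ1).mul huc) hc.dbar.mul_right
        ((tsupport_mul_subset_left.trans (tsupport_dbar_subset φ)).trans hs)
    have i3 : Integrable (fun z => φ z * k' z * f z) := by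
      rw [← memLp_one_iff_integrable]
      exact hf.continuous_mul (hφ.continuous.mul hk's.continuous) hc.mul_right
        (tsupport_mul_subset_left.trans hs)
    have e3 : ∫ z, k' z * (φ z * f z) = - ∫ w, u w * G w := by
      have : ∫ z, dbar (fun z => φ z * u z) z * f z =
          (∫ z, dbar φ z * u z * f z) + ∫ z, φ z * k' z * f z := by
        rw [← integral_add i2 i3]
        congr 1; ext z; rw [e2]; ring
      rw [this] at e1
      have h3 : ∫ w, u w * G w = (∫ z, φ z * u z * g z) + ∫ z, dbar φ z * u z * f z := by
        rw [← integral_add i1 i2]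
        congr 1; ext z; rw [hG]; ring
      have h4 : ∫ z, k' z * (φ z * f z) = ∫ z, φ z * k' z * f z := by
        congr 1; ext z; ring
      rw [h3, h4]
      linear_combination e1
    have hprod : Integrable (fun x : ℂ × ℂ => k' x.1 * ((x.2 - x.1)⁻¹ * G x.2))
        (volume.prod volume) := by
      have hm : AEStronglyMeasurable (fun x : ℂ × ℂ => k' x.1 * ((x.2 - x.1)⁻¹ * G x.2))
          (volume.prod volume) := by
        refine (hk's.continuous.comp continuous_fst).aestronglyMeasurable.mul ?_
        exact (Measurable.aestronglyMeasurable (by fun_prop)).mul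
          (hGi.1.comp_quasiMeasurePreserving Measure.quasiMeasurePreserving_snd)
      refine ⟨hm, ?_⟩
      rw [hasFiniteIntegral_iff_enorm, lintegral_prod _ hm.enorm]
      obtain ⟨M, hM⟩ := hk's.continuous.bounded_above_of_compact_support hk'c
      calc _ ≤ ∫⁻ z, (tsupport k').indicator
            (fun z => ENNReal.ofReal M * rieszPotential (fun w => ‖G w‖ₑ) z) z := by
            apply lintegral_mono
            intro z
            by_cases hz : z ∈ tsupport k'
            · simp only [Set.indicator_of_mem hz]
              simp_rw [enorm_mul (k' z)]
              rw [lintegral_const_mul' _ _ (by finiteness)]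
              gcongr
              · rw [← ofReal_norm]
                exact ENNReal.ofReal_le_ofReal (hM z)
              · exact lintegral_mono fun w => hen z w
            · simp [hz, image_eq_zero_of_notMem_tsupport hz]
        _ < ∞ := by
            rw [lintegral_indicator (isClosed_tsupport k').measurableSet,
              lintegral_const_mul' _ _ (by finiteness)]
            exact ENNReal.mul_lt_top (by finiteness)
              (setLIntegral_rieszPotential_lt_top hGi.1.enorm hGe hk'c.isCompact.measure_ne_top)
    -- Fubini moves the Cauchy kernel from k to G.
    have e4 : ∫ w, u w * G w = (Real.pi : ℂ)⁻¹ * ∫ z, k' z * F z := by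
      have e5 : ∀ w, u w * G w = (Real.pi : ℂ)⁻¹ * ∫ z, k' z * ((w - z)⁻¹ * G w) := by
        intro w
        rw [hu, cauchyTransform, mul_assoc]
        congr 1
        rw [← integral_mul_const, ← integral_sub_left_eq_self _ volume w]
        congr 1
        ext z
        rw [sub_sub_cancel]
        ring
      simp_rw [e5]
      rw [integral_const_mul]
      congr 1
      rw [← integral_integral_swap hprod]
      simp_rw [integral_const_mul, hF]
    have i4 : Integrable (fun z => k' z * F z) := by
      have := hprod.integral_prod_left
      simp_rw [integral_const_mul] at this
      exact this
    have i5 : Integrable (fun z => k' z * (φ z * f z)) := by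
      refine i3.congr (Eventually.of_forall fun z => ?_)
      simp only
      ring
    calc ∫ z, k z • (φ z * f z + (Real.pi : ℂ)⁻¹ * F z)
        = ∫ z, (k' z * (φ z * f z) + (Real.pi : ℂ)⁻¹ * (k' z * F z)) := by
          congr 1; ext z; rw [Complex.real_smul]; ring
      _ = 0 := by
          rw [integral_add i5 (i4.const_mul _), integral_const_mul, e3, e4]
          ring
  filter_upwards [key] with z hz
  linear_combination hz

theorem HasWeakDbar.ae_enorm_le_rieszPotential {Ω : Opens ℂ} {f g : ℂ → ℂ} (h : HasWeakDbar Ω f g)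
    (hf : MemLpLoc f 1 Ω) (hg : MemLpLoc g 1 Ω) {φ : ℂ → ℂ} (hφ : ContDiff ℝ (⊤ : ℕ∞) φ)
    (hc : HasCompactSupport φ) (hs : tsupport φ ⊆ Ω) :
    ∀ᵐ z, ‖φ z * f z‖ₑ ≤ rieszPotential (fun w => ‖φ w * g w + dbar φ w * f w‖ₑ) z := by
  filter_upwards [h.ae_eq_integral hf hg hφ hc hs] with z hz
  rw [hz, enorm_neg, enorm_mul]
  have hpi : ‖(Real.pi : ℂ)⁻¹‖ₑ ≤ 1 := by
    rw [← ofReal_norm, norm_inv, Complex.norm_real, Real.norm_eq_abs, abs_of_pos Real.pi_pos]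
    rw [ENNReal.ofReal_le_one]
    exact inv_le_one_of_one_le₀ (by linarith [Real.pi_gt_three])
  refine (mul_le_of_le_one_left' hpi).trans ((enorm_integral_le_lintegral_enorm _).trans ?_)
  apply lintegral_mono
  intro w
  simp only
  rw [enorm_mul, mul_comm]
  gcongr
  rcases eq_or_ne w z with rfl | hwz
  · simp
  · rw [enorm_inv (sub_ne_zero.2 hwz), ← enorm_neg, neg_sub]

/-- The Sobolev inequality for `∂̄`, localized by a cutoff. -/
theorem exists_eLpNorm_mul_le {p : ℝ} (hp1 : 1 < p) (hp2 : p < 2) :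
    ∃ C : ℝ≥0∞, C ≠ ∞ ∧ ∀ (Ω : Opens ℂ) (f g φ : ℂ → ℂ), HasWeakDbar Ω f g →
      MemLpLoc f (ENNReal.ofReal p) Ω → MemLpLoc g (ENNReal.ofReal p) Ω →
      ContDiff ℝ (⊤ : ℕ∞) φ → HasCompactSupport φ → tsupport φ ⊆ Ω →
      eLpNorm (fun z => φ z * f z) (ENNReal.ofReal (2 * p / (2 - p))) volume ≤
        C * (eLpNorm (fun z => φ z * g z) (ENNReal.ofReal p) volume +
          eLpNorm (fun z => dbar φ z * f z) (ENNReal.ofReal p) volume) := by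
  obtain ⟨C, hC, H⟩ := exists_eLpNorm_rieszPotential_le hp1 hp2
  refine ⟨C, hC, ?_⟩
  intro Ω f g φ h hf hg hφ hc hs
  have hp : (1 : ℝ≥0∞) ≤ ENNReal.ofReal p := by simpa using hp1.le
  have hφ1 : ContDiff ℝ 1 φ := hφ.of_le (by exact_mod_cast le_top)
  have m1 := (hg.continuous_mul hφ.continuous hc hs).1
  have m2 := (hf.continuous_mul (continuous_dbar hφ1) hc.dbar ((tsupport_dbar_subset φ).trans hs)).1
  calc _ ≤ eLpNorm (rieszPotential (fun w => ‖φ w * g w + dbar φ w * f w‖ₑ))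
        (ENNReal.ofReal (2 * p / (2 - p))) volume := by
        apply eLpNorm_mono_enorm_ae
        filter_upwards [h.ae_enorm_le_rieszPotential (hf.mono_exponent hp) (hg.mono_exponent hp)
          hφ hc hs] with z hz
        simpa using hz
    _ ≤ C * eLpNorm (fun w => φ w * g w + dbar φ w * f w) (ENNReal.ofReal p) volume :=
        H _ (m1.add m2)
    _ ≤ _ := by
        gcongr
        exact eLpNorm_add_le m1 m2 hp

/-! ### Hölder, absorption and the Carleman weights. -/

/-- The gain from L^p to L^q in the Sobolev inequality is exactly what multiplication by an L²
potential costs. -/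
theorem holderTriple_two {p : ℝ} (hp1 : 1 < p) (hp2 : p < 2) :
    ENNReal.HolderTriple 2 (ENNReal.ofReal (2 * p / (2 - p))) (ENNReal.ofReal p) := by
  constructor
  have h2p : 0 < 2 - p := by linarith
  have hp0 : 0 < p := by linarith
  rw [show (2 : ℝ≥0∞) = ENNReal.ofReal 2 by simp, ← ENNReal.ofReal_inv_of_pos (by positivity),
    ← ENNReal.ofReal_inv_of_pos (by positivity), ← ENNReal.ofReal_inv_of_pos (by positivity),
    ← ENNReal.ofReal_add (by positivity) (by positivity)]
  congr 1
  field_simp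
  ring

/-- Hölder's inequality for a function dominated by a product with an `L²` potential. -/
theorem eLpNorm_mul_le_of_norm_le {p q : ℝ≥0∞} [ENNReal.HolderTriple 2 q p] {φ g v U : ℂ → ℂ}
    {B : Set ℂ} (hB : MeasurableSet B) (hφ : ∀ z, z ∉ B → φ z = 0)
    (hg : ∀ᵐ z ∂(volume.restrict B), ‖g z‖ ≤ ‖U z‖ * ‖v z‖)
    (hU : AEStronglyMeasurable U (volume.restrict B))
    (hv : AEStronglyMeasurable (fun z => φ z * v z)) :
    eLpNorm (fun z => φ z * g z) p volume ≤
      eLpNorm U 2 (volume.restrict B) * eLpNorm (fun z => φ z * v z) q volume := by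
  have h1 : (fun z => φ z * g z) = B.indicator (fun z => φ z * g z) := by
    ext z
    by_cases hz : z ∈ B
    · simp [hz]
    · simp [hz, hφ z hz]
  rw [h1, eLpNorm_indicator_eq_eLpNorm_restrict hB]
  calc _ ≤ eLpNorm (U • fun z => φ z * v z) p (volume.restrict B) := by
        apply eLpNorm_mono_ae
        filter_upwards [hg] with z hz
        simp only [Pi.smul_apply', smul_eq_mul, norm_mul]
        calc _ ≤ ‖φ z‖ * (‖U z‖ * ‖v z‖) := by gcongr
          _ = _ := by ring
    _ ≤ eLpNorm U 2 (volume.restrict B) * eLpNorm (fun z => φ z * v z) q (volume.restrict B) :=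
        eLpNorm_smul_le_mul_eLpNorm hv.restrict hU
    _ ≤ _ := by
        gcongr
        exact Measure.restrict_le_self

/-- Adding the two inequalities puts at most half of x + y on the right; finiteness of x and y
allows it to be subtracted. -/
theorem ENNReal.add_le_two_mul_of_le_half {x y a b C u : ℝ≥0∞} (hx : x ≠ ∞) (hy : y ≠ ∞)
    (hCu : C * u ≤ 1 / 2) (h1 : x ≤ C * (u * y + a)) (h2 : y ≤ C * (u * x + b)) :
    x + y ≤ 2 * (C * (a + b)) := by
  have h3 : x + y ≤ (x + y) / 2 + C * (a + b) := by
    calc x + y ≤ C * (u * y + a) + C * (u * x + b) := add_le_add h1 h2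
      _ = C * u * (x + y) + C * (a + b) := by ring
      _ ≤ 1 / 2 * (x + y) + C * (a + b) := by gcongr
      _ = _ := by rw [one_div, mul_comm, div_eq_mul_inv]
  have hf : (x + y) / 2 ≠ ∞ := by finiteness
  have h4 : (x + y) / 2 ≤ C * (a + b) := by
    nth_rewrite 1 [← ENNReal.add_halves (x + y)] at h3
    exact (ENNReal.add_le_add_iff_left hf).1 h3
  calc x + y = 2 * ((x + y) / 2) := by rw [ENNReal.mul_div_cancel (by simp) (by simp)]
    _ ≤ _ := by gcongr

/-- Smooth cutoffs at all scales, with the natural bound for the derivative. -/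
theorem exists_cutoff_dbar_le : ∃ M : ℝ, 0 ≤ M ∧ ∀ (c : ℂ) (d : ℝ), 0 < d → ∃ β : ℂ → ℂ,
    ContDiff ℝ (⊤ : ℕ∞) β ∧ (∀ z ∈ closedBall c d, β z = 1) ∧ (∀ z, z ∉ ball c (2 * d) → β z = 0) ∧
    (∀ z, ‖dbar β z‖ ≤ M / d) ∧ (∀ z ∈ ball c d, dbar β z = 0) ∧
    (∀ z, z ∉ closedBall c (2 * d) → dbar β z = 0) := by
  let b : ContDiffBump (0 : ℂ) := ⟨1, 2, one_pos, one_lt_two⟩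
  set b₀ : ℂ → ℂ := fun z => (b z : ℂ) with hb₀
  have hs : ContDiff ℝ (⊤ : ℕ∞) b₀ := Complex.ofRealCLM.contDiff.comp b.contDiff
  have hs1 : ContDiff ℝ 1 b₀ := hs.of_le (by exact_mod_cast le_top)
  have hc : HasCompactSupport b₀ := b.hasCompactSupport.comp_left (g := fun x : ℝ => (x : ℂ)) (by simp)
  -- M bounds ∂̄ of one fixed bump; rescaling by d multiplies it by 1/d.
  obtain ⟨M, hM⟩ := (continuous_dbar hs1).bounded_above_of_compact_support hc.dbar
  refine ⟨M, (norm_nonneg _).trans (hM 0), ?_⟩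
  intro c d hd
  set β : ℂ → ℂ := fun z => b₀ (d⁻¹ • (z - c)) with hβ
  have hn : ∀ z, ‖d⁻¹ • (z - c)‖ = dist z c / d := by
    intro z
    rw [norm_smul, norm_inv, Real.norm_eq_abs, abs_of_pos hd, dist_eq_norm, inv_mul_eq_div]
  have one : ∀ z ∈ closedBall c d, β z = 1 := by
    intro z hz
    have : b (d⁻¹ • (z - c)) = 1 := by
      apply b.one_of_mem_closedBall
      rw [mem_closedBall_zero_iff, hn, div_le_iff₀ hd]
      simpa [b] using hz
    simp only [hβ, hb₀, this, Complex.ofReal_one]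
  have zero : ∀ z, z ∉ ball c (2 * d) → β z = 0 := by
    intro z hz
    have : b (d⁻¹ • (z - c)) = 0 := by
      apply b.zero_of_le_dist
      rw [dist_zero_right, hn, le_div_iff₀ hd]
      simpa [b] using hz
    simp only [hβ, hb₀, this, Complex.ofReal_zero]
  have hlin : ∀ z, HasFDerivAt (fun z : ℂ => d⁻¹ • (z - c)) (d⁻¹ • ContinuousLinearMap.id ℝ ℂ) z :=
    fun z => ((hasFDerivAt_id z).sub_const c).const_smul d⁻¹
  refine ⟨β, hs.comp ((contDiff_id.sub contDiff_const).const_smul d⁻¹), one, zero, ?_, ?_, ?_⟩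
  · intro z
    have h1 : fderiv ℝ β z = (fderiv ℝ b₀ (d⁻¹ • (z - c))).comp (d⁻¹ • ContinuousLinearMap.id ℝ ℂ) :=
      (((hs1.differentiable one_ne_zero) _).hasFDerivAt.comp z (hlin z)).fderiv
    have h1' : ∀ v, fderiv ℝ β z v = (d⁻¹ : ℝ) * fderiv ℝ b₀ (d⁻¹ • (z - c)) v := by
      intro v
      rw [h1, ← Complex.real_smul]
      exact map_smul (fderiv ℝ b₀ (d⁻¹ • (z - c))) d⁻¹ v
    have h2 : dbar β z = (d⁻¹ : ℝ) * dbar b₀ (d⁻¹ • (z - c)) := by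
      rw [dbar, dbar, h1', h1']
      ring
    rw [h2, norm_mul, Complex.norm_real, norm_inv, Real.norm_eq_abs, abs_of_pos hd, inv_mul_eq_div]
    gcongr
    exact hM _
  · intro z hz
    have : β =ᶠ[𝓝 z] fun _ => 1 := by
      filter_upwards [isOpen_ball.mem_nhds hz] with w hw using one w (ball_subset_closedBall hw)
    rw [this.dbar_eq]
    exact dbar_eq_zero_of_differentiableAt (differentiableAt_const _)
  · intro z hz
    have : β =ᶠ[𝓝 z] fun _ => 0 := by
      filter_upwards [isClosed_closedBall.isOpen_compl.mem_nhds hz] with w hw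
      exact zero w fun h => hw (ball_subset_closedBall h)
    rw [this.dbar_eq]
    exact dbar_eq_zero_of_differentiableAt (differentiableAt_const _)

/-- The Carleman weight `(z - c)⁻ⁿ`, cut off to an annulus around `c`. -/
theorem exists_weighted_cutoff : ∃ M : ℝ, 0 ≤ M ∧ ∀ (c : ℂ) (n : ℕ) (r d : ℝ), 0 < d → 2 * d < r →
    ∃ φ : ℂ → ℂ, ContDiff ℝ (⊤ : ℕ∞) φ ∧ HasCompactSupport φ ∧ tsupport φ ⊆ closedBall c (2 * r) ∧
    (∀ z, z ∈ closedBall c r → z ∉ ball c (2 * d) → ‖φ z‖ = (dist z c ^ n)⁻¹) ∧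
    (∀ z, ‖dbar φ z‖ ≤ (closedBall c (2 * r)).indicator (fun _ => M / r ^ (n + 1)) z +
      (closedBall c (2 * d)).indicator (fun _ => M / d ^ (n + 1)) z) := by
  obtain ⟨M, hM0, H⟩ := exists_cutoff_dbar_le
  refine ⟨M, hM0, ?_⟩
  intro c n r d hd hdr
  have hr : 0 < r := by linarith
  obtain ⟨β, hβs, hβ1, hβ0, hβM, hβi, hβo⟩ := H c r hr
  obtain ⟨γ, hγs, hγ1, hγ0, hγM, hγi, hγo⟩ := H c d hd
  set φ : ℂ → ℂ := fun z => ((z - c) ^ n)⁻¹ * (β z - γ z) with hφ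
  -- Both cutoffs equal 1 near c, so their difference removes the pole of the weight.
  have hloc : ∀ z ∈ ball c d, φ =ᶠ[𝓝 z] fun _ => 0 := by
    intro z hz
    filter_upwards [isOpen_ball.mem_nhds hz] with w hw
    have hw' := ball_subset_closedBall hw
    rw [hφ]
    simp only
    rw [hγ1 w hw', hβ1 w (closedBall_subset_closedBall (by linarith) hw')]
    simp
  have hne : ∀ z, z ∉ ball c d → z - c ≠ 0 := by
    intro z hz h0
    apply hz
    rw [sub_eq_zero.1 h0]
    exact mem_ball_self hd
  have hinv : ∀ z, z ∉ ball c d → DifferentiableAt ℂ (fun z => ((z - c) ^ n)⁻¹) z := by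
    intro z hz
    exact ((differentiableAt_id.sub_const c).pow n).inv (pow_ne_zero n (hne z hz))
  have hsupp : tsupport φ ⊆ closedBall c (2 * r) := by
    refine closure_minimal (fun z hz => ?_) isClosed_closedBall
    by_contra h
    apply hz
    simp only [hφ]
    rw [hβ0 z (fun h' => h (ball_subset_closedBall h')), hγ0 z]
    · simp
    · intro h'
      exact h (closedBall_subset_closedBall (by linarith) (ball_subset_closedBall h'))
  refine ⟨φ, ?_, ?_, hsupp, ?_, ?_⟩
  · rw [contDiff_iff_contDiffAt]
    intro z
    by_cases hz : z ∈ ball c d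
    · exact contDiffAt_const.congr_of_eventuallyEq (hloc z hz)
    · refine ContDiffAt.mul ?_ (hβs.sub hγs).contDiffAt
      exact ((contDiffAt_id.sub contDiffAt_const).pow n).inv (pow_ne_zero n (hne z hz))
  · exact (isCompact_closedBall c (2 * r)).of_isClosed_subset (isClosed_tsupport φ) hsupp
  · intro z hz hz'
    simp only [hφ]
    rw [hβ1 z hz, hγ0 z hz', dist_eq_norm]
    simp
  · intro z
    by_cases hz : z ∈ ball c d
    · rw [(hloc z hz).dbar_eq, dbar_eq_zero_of_differentiableAt (differentiableAt_const _), norm_zero]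
      refine add_nonneg ?_ ?_ <;> exact Set.indicator_nonneg (fun _ _ => by positivity) _
    · have hβd : DifferentiableAt ℝ β z := hβs.contDiffAt.differentiableAt (by simp)
      have hγd : DifferentiableAt ℝ γ z := hγs.contDiffAt.differentiableAt (by simp)
      have e : dbar φ z = ((z - c) ^ n)⁻¹ * dbar β z - ((z - c) ^ n)⁻¹ * dbar γ z := by
        rw [hφ, dbar_mul (g := fun w => β w - γ w) ((hinv z hz).restrictScalars ℝ) (hβd.sub hγd),
          dbar_eq_zero_of_differentiableAt (hinv z hz), dbar_sub hβd hγd]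
        ring
      -- The derivative of a cutoff at scale e lives where e ≤ |z - c| ≤ 2e, and there the weight is
      -- at most e⁻ⁿ.
      have est : ∀ (θ : ℂ → ℂ) (e : ℝ), 0 < e → (∀ z, ‖dbar θ z‖ ≤ M / e) →
          (∀ z ∈ ball c e, dbar θ z = 0) → (∀ z, z ∉ closedBall c (2 * e) → dbar θ z = 0) →
          ‖((z - c) ^ n)⁻¹ * dbar θ z‖ ≤
            (closedBall c (2 * e)).indicator (fun _ => M / e ^ (n + 1)) z := by
        intro θ e he h1 h2 h3
        by_cases hz1 : z ∈ closedBall c (2 * e)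
        · rw [Set.indicator_of_mem hz1]
          by_cases hz2 : z ∈ ball c e
          · rw [h2 z hz2, mul_zero, norm_zero]; positivity
          · have : e ≤ ‖z - c‖ := by rw [← dist_eq_norm]; simpa using hz2
            rw [norm_mul, norm_inv, norm_pow]
            calc _ ≤ (e ^ n)⁻¹ * (M / e) := by
                  gcongr
                  exact h1 z
              _ = _ := by field_simp; ring
        · rw [h3 z hz1, Set.indicator_of_notMem hz1]; simp
      rw [e]
      exact (norm_sub_le _ _).trans (add_le_add (est β r hr hβM hβi hβo) (est γ d hd hγM hγi hγo))

theorem eLpNorm_mul_le_add_of_norm_le_indicator {p : ℝ≥0∞} (hp : 1 ≤ p) {k v : ℂ → ℂ}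
    {A B : Set ℂ} (hA : MeasurableSet A) (hB : MeasurableSet B) {a b : ℝ} (ha : 0 ≤ a) (hb : 0 ≤ b)
    (hk : ∀ z, ‖k z‖ ≤ A.indicator (fun _ => a) z + B.indicator (fun _ => b) z)
    (hvA : AEStronglyMeasurable v (volume.restrict A))
    (hvB : AEStronglyMeasurable v (volume.restrict B)) :
    eLpNorm (fun z => k z * v z) p volume ≤ ENNReal.ofReal a * eLpNorm v p (volume.restrict A) +
      ENNReal.ofReal b * eLpNorm v p (volume.restrict B) := by
  have e : ∀ (t : ℝ) (S : Set ℂ), 0 ≤ t → MeasurableSet S →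
      eLpNorm (S.indicator fun z => t * ‖v z‖) p volume =
        ENNReal.ofReal t * eLpNorm v p (volume.restrict S) := by
    intro t S ht hS
    rw [eLpNorm_indicator_eq_eLpNorm_restrict hS, ← Real.enorm_of_nonneg ht,
      ← eLpNorm_norm v]
    exact eLpNorm_const_smul t (fun z => ‖v z‖) p (volume.restrict S)
  have m : ∀ (t : ℝ) (S : Set ℂ), MeasurableSet S → AEStronglyMeasurable v (volume.restrict S) →
      AEStronglyMeasurable (S.indicator fun z => t * ‖v z‖) volume := by
    intro t S hS hv
    exact (aestronglyMeasurable_indicator_iff hS).2 (hv.norm.const_mul t)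
  rw [← e a A ha hA, ← e b B hb hB]
  refine le_trans (eLpNorm_mono_real fun z => ?_) (eLpNorm_add_le (m a A hA hvA) (m b B hB hvB) hp)
  rw [norm_mul]
  refine (mul_le_mul_of_nonneg_right (hk z) (norm_nonneg _)).trans (le_of_eq ?_)
  rw [add_mul, Pi.add_apply]
  by_cases h1 : z ∈ A <;> by_cases h2 : z ∈ B <;> simp [h1, h2]

/-! ### Vanishing to infinite order and local unique continuation. -/

/-- `v` vanishes to infinite order at `c` in the `L^q` sense. -/
def VanishesToInfiniteOrder (v : ℂ → ℂ) (q : ℝ≥0∞) (c : ℂ) : Prop :=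
  ∀ n : ℕ, ∃ C : ℝ, ∀ᶠ ε : ℝ in 𝓝[>] 0,
    eLpNorm v q (volume.restrict (ball c ε)) ≤ ENNReal.ofReal (C * ε ^ n)

/-- This removes the inner commutator term of the Carleman estimate. Decay of order n + 2 beats
d^(-(n+1)) and leaves one power of d. -/
theorem VanishesToInfiniteOrder.tendsto_eLpNorm {v : ℂ → ℂ} {p q : ℝ≥0∞} {c : ℂ}
    (h : VanishesToInfiniteOrder v q c) (hpq : p ≤ q) {r : ℝ} (hr : 0 < r)
    (hv : AEStronglyMeasurable v (volume.restrict (closedBall c r))) {M : ℝ} (hM : 0 ≤ M) (n : ℕ) :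
    Tendsto (fun d : ℝ => ENNReal.ofReal (M / d ^ (n + 1)) *
      eLpNorm v p (volume.restrict (closedBall c (2 * d)))) (𝓝[>] 0) (𝓝 0) := by
  obtain ⟨C, hC⟩ := h (n + 2)
  have h3 : Tendsto (fun d : ℝ => 3 * d) (𝓝[>] 0) (𝓝[>] 0) := by
    refine tendsto_nhdsWithin_iff.2 ⟨?_, ?_⟩
    · have : Tendsto (fun d : ℝ => 3 * d) (𝓝 0) (𝓝 (3 * 0)) := tendsto_id.const_mul 3
      rw [mul_zero] at this
      exact this.mono_left nhdsWithin_le_nhds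
    · filter_upwards [self_mem_nhdsWithin] with d hd
      have : (0 : ℝ) < d := hd
      exact mul_pos three_pos this
  have hlim : Tendsto (fun d : ℝ => ENNReal.ofReal (M * C * 3 ^ (n + 2) * d)) (𝓝[>] 0) (𝓝 0) := by
    have : Tendsto (fun d : ℝ => M * C * 3 ^ (n + 2) * d) (𝓝 0) (𝓝 (M * C * 3 ^ (n + 2) * 0)) :=
      tendsto_id.const_mul _
    rw [mul_zero] at this
    simpa using ENNReal.tendsto_ofReal (this.mono_left (nhdsWithin_le_nhds (s := Set.Ioi 0)))
  refine tendsto_of_tendsto_of_tendsto_of_le_of_le' tendsto_const_nhds hlim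
    (Eventually.of_forall fun _ => zero_le) ?_
  filter_upwards [h3.eventually hC, self_mem_nhdsWithin,
    nhdsWithin_le_nhds (Iio_mem_nhds (show (0 : ℝ) < 1 / 6 by norm_num)),
    nhdsWithin_le_nhds (Iio_mem_nhds (show (0 : ℝ) < r / 3 by positivity))] with d hd hd0 hd1 hd2
  have hd0 : 0 < d := hd0
  have hd1 : d < 1 / 6 := hd1
  have hd2 : d < r / 3 := hd2
  -- Radius 3d leaves room for the closed ball of radius 2d. As 3d < 1/2, the volume is at most 1,
  -- so the L^p norm is bounded by the L^q norm without a constant.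
  have hvol : volume.restrict (ball c (3 * d)) Set.univ ≤ 1 := by
    rw [Measure.restrict_apply_univ, Complex.volume_ball, ← ENNReal.ofReal_pow (by positivity),
      ← ENNReal.ofReal_coe_nnreal, ← ENNReal.ofReal_mul (by positivity), ENNReal.ofReal_le_one]
    have : (3 * d) ^ 2 ≤ (1 / 2) ^ 2 := by gcongr; linarith
    have := Real.pi_lt_four
    have := Real.pi_pos
    rw [NNReal.coe_real_pi]
    nlinarith
  have hv' : AEStronglyMeasurable v (volume.restrict (ball c (3 * d))) :=
    hv.mono_measure (Measure.restrict_mono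
      (ball_subset_closedBall.trans (closedBall_subset_closedBall (by linarith))) le_rfl)
  have e1 : eLpNorm v p (volume.restrict (closedBall c (2 * d))) ≤
      ENNReal.ofReal (C * (3 * d) ^ (n + 2)) := by
    calc _ ≤ eLpNorm v p (volume.restrict (ball c (3 * d))) :=
          eLpNorm_mono_measure _ (Measure.restrict_mono
            (closedBall_subset_ball (by linarith)) le_rfl)
      _ ≤ eLpNorm v q (volume.restrict (ball c (3 * d))) := by
          rcases eq_or_ne p 0 with rfl | hp0
          · simp
          refine (eLpNorm_le_eLpNorm_mul_rpow_measure_univ hpq hv').trans ?_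
          refine mul_le_of_le_one_right' (ENNReal.rpow_le_one hvol ?_)
          rcases eq_or_ne q ∞ with rfl | hq
          · simp
          · rw [sub_nonneg]
            have : 0 < p.toReal := ENNReal.toReal_pos hp0 (ne_top_of_le_ne_top hq hpq)
            exact one_div_le_one_div_of_le this (ENNReal.toReal_mono hq hpq)
      _ ≤ _ := hd
  calc _ ≤ ENNReal.ofReal (M / d ^ (n + 1)) * ENNReal.ofReal (C * (3 * d) ^ (n + 2)) := by gcongr
    _ = _ := by
        rw [← ENNReal.ofReal_mul (by positivity)]
        congr 1
        field_simp
        ring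

theorem ofReal_mul_eLpNorm_le_of_le_norm {q : ℝ≥0∞} {φ v : ℂ → ℂ} {A : Set ℂ} (hA : MeasurableSet A)
    {a : ℝ} (ha : 0 ≤ a) (h : ∀ z ∈ A, a ≤ ‖φ z‖) :
    ENNReal.ofReal a * eLpNorm v q (volume.restrict A) ≤ eLpNorm (fun z => φ z * v z) q volume := by
  calc _ = eLpNorm (a • v) q (volume.restrict A) := by
        rw [eLpNorm_const_smul, Real.enorm_of_nonneg ha]
    _ ≤ eLpNorm (fun z => φ z * v z) q (volume.restrict A) := by
        apply eLpNorm_mono_ae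
        filter_upwards [ae_restrict_mem hA] with z hz
        rw [Pi.smul_apply, norm_smul, norm_mul, Real.norm_eq_abs, abs_of_nonneg ha]
        gcongr
        exact h z hz
    _ ≤ _ := eLpNorm_mono_measure _ Measure.restrict_le_self

/-- **Strong unique continuation**, local form with a quantitative radius. -/
theorem exists_ae_eq_zero_of_vanishesToInfiniteOrder {p : ℝ} (hp1 : 1 < p) (hp2 : p < 2) :
    ∃ u : ℝ≥0∞, u ≠ 0 ∧ ∀ (Ω : Opens ℂ) (v₁ v₂ g₁ g₂ U : ℂ → ℂ) (c : ℂ) (r : ℝ), 0 < r →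
      closedBall c (2 * r) ⊆ (Ω : Set ℂ) → HasWeakDbar Ω v₁ g₁ → HasWeakDbar Ω v₂ g₂ →
      MemLpLoc v₁ (ENNReal.ofReal p) Ω → MemLpLoc v₂ (ENNReal.ofReal p) Ω →
      MemLpLoc g₁ (ENNReal.ofReal p) Ω → MemLpLoc g₂ (ENNReal.ofReal p) Ω →
      (∀ᵐ z ∂(volume.restrict (Ω : Set ℂ)), ‖g₁ z‖ ≤ ‖U z‖ * ‖v₂ z‖) →
      (∀ᵐ z ∂(volume.restrict (Ω : Set ℂ)), ‖g₂ z‖ ≤ ‖U z‖ * ‖v₁ z‖) →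
      AEStronglyMeasurable U (volume.restrict (closedBall c (2 * r))) →
      eLpNorm U 2 (volume.restrict (closedBall c (2 * r))) ≤ u →
      VanishesToInfiniteOrder v₁ (ENNReal.ofReal (2 * p / (2 - p))) c →
      VanishesToInfiniteOrder v₂ (ENNReal.ofReal (2 * p / (2 - p))) c →
      ∀ᵐ z ∂(volume.restrict (closedBall c (r / 2))), v₁ z = 0 ∧ v₂ z = 0 := by
  obtain ⟨C, hC, hCest⟩ := exists_eLpNorm_mul_le hp1 hp2
  obtain ⟨M, hM, hcut⟩ := exists_weighted_cutoff
  have hp : (1 : ℝ≥0∞) ≤ ENNReal.ofReal p := by simpa using hp1.le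
  have := holderTriple_two hp1 hp2
  set q : ℝ≥0∞ := ENNReal.ofReal (2 * p / (2 - p)) with hq
  have hpq : ENNReal.ofReal p ≤ q := by
    apply ENNReal.ofReal_le_ofReal
    rw [le_div_iff₀ (by linarith)]
    nlinarith
  -- Chosen so that C‖U‖₂ ≤ 1/2; C + 1 also covers C = 0.
  refine ⟨(2 * (C + 1))⁻¹, ENNReal.inv_ne_zero.2 (by finiteness), ?_⟩
  intro Ω v₁ v₂ g₁ g₂ U c r hr hΩ hw₁ hw₂ hv₁ hv₂ hg₁ hg₂ hb₁ hb₂ hUm hU hd₁ hd₂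
  set B := closedBall c (2 * r) with hB
  have hBc : IsCompact B := isCompact_closedBall _ _
  have hCu : C * eLpNorm U 2 (volume.restrict B) ≤ 1 / 2 := by
    calc _ ≤ (C + 1) * (2 * (C + 1))⁻¹ := by gcongr; exact le_self_add
      _ = 1 / 2 := by
        rw [ENNReal.mul_inv (by simp) (by simp), mul_left_comm, ENNReal.mul_inv_cancel (by simp)
          (by finiteness), mul_one, one_div]
  have hm₁ := (hv₁ B hBc hΩ).1
  have hm₂ := (hv₂ B hBc hΩ).1
  have hP₁ := (hv₁ B hBc hΩ).2
  have hP₂ := (hv₂ B hBc hΩ).2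
  set P₁ := eLpNorm v₁ (ENNReal.ofReal p) (volume.restrict B)
  set P₂ := eLpNorm v₂ (ENNReal.ofReal p) (volume.restrict B)
  have main : ∀ (n : ℕ) (d ρ : ℝ), 0 < d → 2 * d < r → 2 * d ≤ ρ →
      ENNReal.ofReal ((r / 2) ^ n)⁻¹ *
        (eLpNorm v₁ q (volume.restrict (closedBall c (r / 2) \ ball c ρ)) +
          eLpNorm v₂ q (volume.restrict (closedBall c (r / 2) \ ball c ρ))) ≤
      2 * (C * ((ENNReal.ofReal (M / r ^ (n + 1)) * P₁ + ENNReal.ofReal (M / d ^ (n + 1)) *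
          eLpNorm v₁ (ENNReal.ofReal p) (volume.restrict (closedBall c (2 * d)))) +
        (ENNReal.ofReal (M / r ^ (n + 1)) * P₂ + ENNReal.ofReal (M / d ^ (n + 1)) *
          eLpNorm v₂ (ENNReal.ofReal p) (volume.restrict (closedBall c (2 * d)))))) := by
    intro n d ρ hd hdr hdρ
    obtain ⟨φ, hφs, hφc, hφB, hφn, hφd⟩ := hcut c n r d hd hdr
    have hφΩ : tsupport φ ⊆ Ω := hφB.trans hΩ
    have hφ0 : ∀ z, z ∉ B → φ z = 0 := fun z hz =>
      image_eq_zero_of_notMem_tsupport fun h => hz (hφB h)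
    have hφ1 : ContDiff ℝ 1 φ := hφs.of_le (by exact_mod_cast le_top)
    have sub : closedBall c (2 * d) ⊆ B := closedBall_subset_closedBall (by linarith)
    -- Absorption needs a priori finite L^q norms; the Sobolev inequality itself supplies them.
    have fin : ∀ v g : ℂ → ℂ, HasWeakDbar Ω v g → MemLpLoc v (ENNReal.ofReal p) Ω →
        MemLpLoc g (ENNReal.ofReal p) Ω → eLpNorm (fun z => φ z * v z) q volume ≠ ∞ := by
      intro v g hw hv hg
      refine ne_top_of_le_ne_top ?_ (hCest Ω v g φ hw hv hg hφs hφc hφΩ)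
      have h1 := (hg.continuous_mul hφs.continuous hφc hφΩ).2.ne
      have h2 := (hv.continuous_mul (continuous_dbar hφ1) hφc.dbar
        ((tsupport_dbar_subset φ).trans hφΩ)).2.ne
      exact ENNReal.mul_ne_top hC (ENNReal.add_ne_top.2 ⟨h1, h2⟩)
    have est : ∀ v g v' : ℂ → ℂ, HasWeakDbar Ω v g → MemLpLoc v (ENNReal.ofReal p) Ω →
        MemLpLoc g (ENNReal.ofReal p) Ω → MemLpLoc v' (ENNReal.ofReal p) Ω →
        (∀ᵐ z ∂(volume.restrict (Ω : Set ℂ)), ‖g z‖ ≤ ‖U z‖ * ‖v' z‖) →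
        eLpNorm (fun z => φ z * v z) q volume ≤ C * (eLpNorm U 2 (volume.restrict B) *
          eLpNorm (fun z => φ z * v' z) q volume + (ENNReal.ofReal (M / r ^ (n + 1)) *
          eLpNorm v (ENNReal.ofReal p) (volume.restrict B) + ENNReal.ofReal (M / d ^ (n + 1)) *
          eLpNorm v (ENNReal.ofReal p) (volume.restrict (closedBall c (2 * d))))) := by
      intro v g v' hw hv hg hv' hb
      refine (hCest Ω v g φ hw hv hg hφs hφc hφΩ).trans ?_
      gcongr
      · exact eLpNorm_mul_le_of_norm_le measurableSet_closedBall hφ0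
          (ae_restrict_of_ae_restrict_of_subset hΩ hb) hUm
          (hv'.continuous_mul hφs.continuous hφc hφΩ).1
      · have hvB := (hv B hBc hΩ).1
        exact eLpNorm_mul_le_add_of_norm_le_indicator hp measurableSet_closedBall
          measurableSet_closedBall (by positivity) (by positivity) hφd hvB
          (hvB.mono_measure (Measure.restrict_mono sub le_rfl))
    have low : ∀ v : ℂ → ℂ, ENNReal.ofReal ((r / 2) ^ n)⁻¹ *
        eLpNorm v q (volume.restrict (closedBall c (r / 2) \ ball c ρ)) ≤
          eLpNorm (fun z => φ z * v z) q volume := by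
      intro v
      refine ofReal_mul_eLpNorm_le_of_le_norm
        (measurableSet_closedBall.diff measurableSet_ball) (by positivity) ?_
      rintro z ⟨hz1, hz2⟩
      have hρ : ρ ≤ dist z c := by simpa using hz2
      have hz1' : dist z c ≤ r / 2 := hz1
      rw [hφn z (closedBall_subset_closedBall (by linarith) hz1)
        (fun h => hz2 (ball_subset_ball hdρ h))]
      have : 0 < dist z c := by linarith
      gcongr
    rw [mul_add]
    exact (add_le_add (low v₁) (low v₂)).trans
      (ENNReal.add_le_two_mul_of_le_half (fin v₁ g₁ hw₁ hv₁ hg₁) (fin v₂ g₂ hw₂ hv₂ hg₂) hCu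
        (est v₁ g₁ v₂ hw₁ hv₁ hg₁ hv₂ hb₁) (est v₂ g₂ v₁ hw₂ hv₂ hg₂ hv₁ hb₂))
  have annulus : ∀ ρ : ℝ, 0 < ρ →
      eLpNorm v₁ q (volume.restrict (closedBall c (r / 2) \ ball c ρ)) +
        eLpNorm v₂ q (volume.restrict (closedBall c (r / 2) \ ball c ρ)) = 0 := by
    intro ρ hρ
    set X := eLpNorm v₁ q (volume.restrict (closedBall c (r / 2) \ ball c ρ)) +
        eLpNorm v₂ q (volume.restrict (closedBall c (r / 2) \ ball c ρ)) with hX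
    -- With n and ρ fixed, d tends to zero and the inner terms disappear.
    have step : ∀ n : ℕ, ENNReal.ofReal ((r / 2) ^ n)⁻¹ * X ≤
        2 * (C * (ENNReal.ofReal (M / r ^ (n + 1)) * P₁ + ENNReal.ofReal (M / r ^ (n + 1)) * P₂)) := by
      intro n
      have t₁ := hd₁.tendsto_eLpNorm hpq (by positivity) hm₁ hM n
      have t₂ := hd₂.tendsto_eLpNorm hpq (by positivity) hm₂ hM n
      have t := ENNReal.Tendsto.const_mul (a := 2) (ENNReal.Tendsto.const_mul (a := C)
        ((t₁.const_add (ENNReal.ofReal (M / r ^ (n + 1)) * P₁)).add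
          (t₂.const_add (ENNReal.ofReal (M / r ^ (n + 1)) * P₂))) (Or.inr hC)) (Or.inr (by simp))
      rw [add_zero, add_zero] at t
      refine ge_of_tendsto t ?_
      filter_upwards [self_mem_nhdsWithin,
        nhdsWithin_le_nhds (Iio_mem_nhds (show (0 : ℝ) < r / 2 by positivity)),
        nhdsWithin_le_nhds (Iio_mem_nhds (show (0 : ℝ) < ρ / 2 by positivity))] with d h1 h2 h3
      have h2 : d < r / 2 := h2
      have h3 : d < ρ / 2 := h3
      exact main n d ρ h1 (by linarith) (by linarith)
    -- Now n is free: (r/2)ⁿ / rⁿ⁺¹ = 2⁻ⁿ / r.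
    have bound : ∀ n : ℕ, X ≤ 2 * (C * (P₁ + P₂)) * ENNReal.ofReal (M / r * (1 / 2) ^ n) := by
      intro n
      calc X = ENNReal.ofReal ((r / 2) ^ n) * (ENNReal.ofReal ((r / 2) ^ n)⁻¹ * X) := by
            rw [← mul_assoc, ← ENNReal.ofReal_mul (by positivity),
              mul_inv_cancel₀ (by positivity), ENNReal.ofReal_one, one_mul]
        _ ≤ ENNReal.ofReal ((r / 2) ^ n) * (2 * (C * (ENNReal.ofReal (M / r ^ (n + 1)) * P₁ +
            ENNReal.ofReal (M / r ^ (n + 1)) * P₂))) := by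
            exact mul_le_mul_right (step n) _
        _ = 2 * (C * (P₁ + P₂)) * (ENNReal.ofReal ((r / 2) ^ n) *
              ENNReal.ofReal (M / r ^ (n + 1))) := by ring
        _ = _ := by
            rw [← ENNReal.ofReal_mul (by positivity)]
            congr 2
            rw [div_pow, div_pow, one_pow]
            field_simp
            ring
    have lim : Tendsto (fun n : ℕ => 2 * (C * (P₁ + P₂)) * ENNReal.ofReal (M / r * (1 / 2) ^ n))
        atTop (𝓝 0) := by
      have h1 : Tendsto (fun n : ℕ => M / r * (1 / 2 : ℝ) ^ n) atTop (𝓝 (M / r * 0)) :=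
        (tendsto_pow_atTop_nhds_zero_of_lt_one (by norm_num) (by norm_num)).const_mul _
      have h2 := ENNReal.Tendsto.const_mul (a := 2 * (C * (P₁ + P₂))) (ENNReal.tendsto_ofReal h1)
        (Or.inr (by finiteness))
      simpa using h2
    exact le_antisymm (ge_of_tendsto lim (Eventually.of_forall bound)) zero_le
  have hq0 : q ≠ 0 := (lt_of_lt_of_le one_pos (hp.trans hpq)).ne'
  have hA : ∀ k : ℕ, ∀ᵐ z, z ∈ closedBall c (r / 2) \ ball c (1 / ((k : ℝ) + 1)) →
      v₁ z = 0 ∧ v₂ z = 0 := by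
    intro k
    have h := add_eq_zero.1 (annulus (1 / ((k : ℝ) + 1)) (by positivity))
    have sub : closedBall c (r / 2) \ ball c (1 / ((k : ℝ) + 1)) ⊆ B :=
      Set.sdiff_subset.trans (closedBall_subset_closedBall (by linarith))
    have e₁ := (eLpNorm_eq_zero_iff (hm₁.mono_measure (Measure.restrict_mono sub le_rfl)) hq0).1 h.1
    have e₂ := (eLpNorm_eq_zero_iff (hm₂.mono_measure (Measure.restrict_mono sub le_rfl)) hq0).1 h.2
    rw [← ae_restrict_iff' (measurableSet_closedBall.diff measurableSet_ball)]
    filter_upwards [e₁, e₂] with z h1 h2 using ⟨h1, h2⟩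
  have hne : ∀ᵐ z : ℂ, z ≠ c := by simp [ae_iff]
  rw [ae_restrict_iff' measurableSet_closedBall]
  filter_upwards [ae_all_iff.2 hA, hne] with z hz hzc hzb
  obtain ⟨k, hk⟩ := exists_nat_one_div_lt (dist_pos.2 hzc)
  exact hz k ⟨hzb, by simpa using hk.le⟩

/-! ### Calculus of weak derivatives. -/

theorem MemLpLoc.locallyIntegrableOn {F : Type*} [NormedAddCommGroup F] {Ω : Opens ℂ} {g : ℂ → F} (hg : MemLpLoc g 1 Ω) :
    LocallyIntegrableOn g (Ω : Set ℂ) := by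
  rw [locallyIntegrableOn_iff Ω.isOpen.isLocallyClosed]
  intro K hK hKc
  exact memLp_one_iff_integrable.1 (hg K hKc hK)

section

variable {F G : Type*} [NormedAddCommGroup F] [NormedSpace ℝ F] [NormedAddCommGroup G]
  [NormedSpace ℝ G] {Ω : Opens ℂ}

theorem MemLpLoc.integrable_smul {g : ℂ → F} (hg : MemLpLoc g 1 Ω) {φ : ℂ → ℝ} (hφ : Continuous φ)
    (hc : HasCompactSupport φ) (hs : tsupport φ ⊆ Ω) : Integrable (fun z => φ z • g z) :=
  memLp_one_iff_integrable.1 (hg.continuous_smul hφ hc hs)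

theorem MemLpLoc.clm_comp {r : ℝ≥0∞} {g : ℂ → F} (hg : MemLpLoc g r Ω) (L : F →L[ℝ] G) :
    MemLpLoc (fun z => L (g z)) r Ω :=
  fun K hK hKΩ => L.comp_memLp' (hg K hK hKΩ)

theorem isWeakDeriv_iff {v : ℂ} {f g : ℂ → F} : IsWeakDeriv Ω v f g ↔
    ∀ φ : ℂ → ℝ, ContDiff ℝ (⊤ : ℕ∞) φ → HasCompactSupport φ → tsupport φ ⊆ Ω →
      ∫ z, (fderiv ℝ φ z v) • f z = - ∫ z, φ z • g z := by
  have e : ∀ (φ : ℂ → ℝ) (h : ℂ → F), tsupport φ ⊆ Ω →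
      ∫ z in (Ω : Set ℂ), φ z • h z = ∫ z, φ z • h z := by
    intro φ h hs
    apply setIntegral_eq_integral_of_forall_compl_eq_zero
    intro z hz
    rw [image_eq_zero_of_notMem_tsupport (fun h' => hz (hs h')), zero_smul]
  have hd : ∀ φ : ℂ → ℝ, tsupport (fun z => fderiv ℝ φ z v) ⊆ tsupport φ :=
    fun φ => tsupport_fderiv_apply_subset ℝ v
  constructor
  · intro h φ hφ hc hs
    have := h ⟨φ, hφ, hc, hs⟩
    simp only [TestFunction.coe_mk] at this
    rwa [e _ _ ((hd φ).trans hs), e _ _ hs] at this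
  · intro h φ
    have := h φ φ.contDiff φ.hasCompactSupport φ.tsupport_subset
    rwa [e _ _ ((hd φ).trans φ.tsupport_subset), e _ _ φ.tsupport_subset]

theorem ContDiff.continuous_fderiv_apply_const {φ : ℂ → F} (hφ : ContDiff ℝ (⊤ : ℕ∞) φ) (v : ℂ) :
    Continuous fun z => fderiv ℝ φ z v :=
  (hφ.continuous_fderiv (by simp)).clm_apply continuous_const

theorem IsWeakDeriv.clm_comp [CompleteSpace F] [CompleteSpace G] {v : ℂ} {f g : ℂ → F}
    (h : IsWeakDeriv Ω v f g) (hf : MemLpLoc f 1 Ω) (hg : MemLpLoc g 1 Ω) (L : F →L[ℝ] G) :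
    IsWeakDeriv Ω v (fun z => L (f z)) (fun z => L (g z)) := by
  rw [isWeakDeriv_iff] at h ⊢
  intro φ hφ hc hs
  have i1 := hf.integrable_smul (hφ.continuous_fderiv_apply_const v) (hc.fderiv_apply ℝ v)
    ((tsupport_fderiv_apply_subset ℝ v).trans hs)
  have i2 := hg.integrable_smul hφ.continuous hc hs
  have e := congrArg L (h φ hφ hc hs)
  rw [map_neg, ← L.integral_comp_comm i1, ← L.integral_comp_comm i2] at e
  simpa using e

/-- The Sobolev condition and the kernel condition each provide their own weak derivatives.
Uniqueness transfers the equation to those known to be in L^p. -/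
theorem IsWeakDeriv.ae_eq [CompleteSpace F] {v : ℂ} {f g g' : ℂ → F} (h : IsWeakDeriv Ω v f g)
    (h' : IsWeakDeriv Ω v f g') (hg : MemLpLoc g 1 Ω) (hg' : MemLpLoc g' 1 Ω) :
    g =ᵐ[volume.restrict (Ω : Set ℂ)] g' := by
  rw [isWeakDeriv_iff] at h h'
  have key := Ω.isOpen.ae_eq_zero_of_integral_contDiff_smul_eq_zero (μ := volume)
    (hg.locallyIntegrableOn.sub hg'.locallyIntegrableOn) ?_
  · rw [Filter.EventuallyEq, ae_restrict_iff' Ω.isOpen.measurableSet]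
    filter_upwards [key] with z hz hzΩ
    exact sub_eq_zero.1 (hz hzΩ)
  · intro φ hφ hc hs
    simp only [Pi.sub_apply, smul_sub]
    rw [integral_sub (hg.integrable_smul hφ.continuous hc hs)
      (hg'.integrable_smul hφ.continuous hc hs), sub_eq_zero, ← neg_inj, ← h φ hφ hc hs,
      ← h' φ hφ hc hs]

end

/-- Weak derivatives may be tested against complex-valued functions. -/
theorem IsWeakDeriv.integral_mul_eq {Ω : Opens ℂ} {v : ℂ} {f g : ℂ → ℂ} (h : IsWeakDeriv Ω v f g)
    (hf : MemLpLoc f 1 Ω) (hg : MemLpLoc g 1 Ω) {φ : ℂ → ℂ} (hφ : ContDiff ℝ (⊤ : ℕ∞) φ)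
    (hc : HasCompactSupport φ) (hs : tsupport φ ⊆ Ω) :
    ∫ z, fderiv ℝ φ z v * f z = - ∫ z, φ z * g z := by
  rw [isWeakDeriv_iff] at h
  have part : ∀ L : ℂ →L[ℝ] ℝ, ContDiff ℝ (⊤ : ℕ∞) (fun z => L (φ z)) ∧
      HasCompactSupport (fun z => L (φ z)) ∧ tsupport (fun z => L (φ z)) ⊆ Ω ∧
      ∀ z, fderiv ℝ (fun z => L (φ z)) z v = L (fderiv ℝ φ z v) := by
    intro L
    refine ⟨L.contDiff.comp hφ, hc.comp_left (map_zero L),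
      (tsupport_comp_subset (map_zero L) φ).trans hs, fun z => ?_⟩
    have hd : DifferentiableAt ℝ φ z := hφ.contDiffAt.differentiableAt (by simp)
    have hL : HasFDerivAt (fun z => L (φ z)) (L.comp (fderiv ℝ φ z)) z :=
      L.hasFDerivAt.comp z hd.hasFDerivAt
    rw [hL.fderiv]
    rfl
  obtain ⟨r1, r2, r3, r4⟩ := part Complex.reCLM
  obtain ⟨i1, i2, i3, i4⟩ := part Complex.imCLM
  have er := h _ r1 r2 r3
  have ei := h _ i1 i2 i3
  have jr := hg.integrable_smul r1.continuous r2 r3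
  have ji := hg.integrable_smul i1.continuous i2 i3
  have kr := hf.integrable_smul (r1.continuous_fderiv_apply_const v) (r2.fderiv_apply ℝ v)
    ((tsupport_fderiv_apply_subset ℝ v).trans r3)
  have ki := hf.integrable_smul (i1.continuous_fderiv_apply_const v) (i2.fderiv_apply ℝ v)
    ((tsupport_fderiv_apply_subset ℝ v).trans i3)
  simp_rw [r4] at er kr
  simp_rw [i4] at ei ki
  have split : ∀ w u : ℂ, w * u = Complex.reCLM w • u + Complex.I * (Complex.imCLM w • u) := by
    intro w u
    conv_lhs => rw [← Complex.re_add_im w]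
    simp only [Complex.reCLM_apply, Complex.imCLM_apply, Complex.real_smul]
    ring
  simp only [fun z => split (fderiv ℝ φ z v) (f z), fun z => split (φ z) (g z)]
  rw [integral_add kr (ki.const_mul _), integral_add jr (ji.const_mul _), integral_const_mul,
    integral_const_mul, er, ei]
  ring

theorem IsWeakDeriv.hasWeakDbar {Ω : Opens ℂ} {f fx fy : ℂ → ℂ} (hx : IsWeakDeriv Ω 1 f fx)
    (hy : IsWeakDeriv Ω Complex.I f fy) (hf : MemLpLoc f 1 Ω) (hfx : MemLpLoc fx 1 Ω)
    (hfy : MemLpLoc fy 1 Ω) : HasWeakDbar Ω f (fun z => (fx z + Complex.I * fy z) / 2) := by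
  intro φ hφ hc hs
  have ex := hx.integral_mul_eq hf hfx hφ hc hs
  have ey := hy.integral_mul_eq hf hfy hφ hc hs
  have k : ∀ v : ℂ, Integrable fun z => fderiv ℝ φ z v * f z := fun v =>
    memLp_one_iff_integrable.1 (hf.continuous_mul (hφ.continuous_fderiv_apply_const v)
      (hc.fderiv_apply ℝ v) ((tsupport_fderiv_apply_subset ℝ v).trans hs))
  have jx := memLp_one_iff_integrable.1 (hfx.continuous_mul hφ.continuous hc hs)
  have jy := memLp_one_iff_integrable.1 (hfy.continuous_mul hφ.continuous hc hs)
  have e1 : ∀ z, dbar φ z * f z =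
      (fderiv ℝ φ z 1 * f z + Complex.I * (fderiv ℝ φ z Complex.I * f z)) / 2 := by
    intro z; rw [dbar]; ring
  have e2 : ∀ z, φ z * ((fx z + Complex.I * fy z) / 2) =
      (φ z * fx z + Complex.I * (φ z * fy z)) / 2 := by
    intro z; ring
  simp_rw [e1, e2]
  rw [integral_div, integral_div, integral_add (k 1) ((k _).const_mul _),
    integral_add jx (jy.const_mul _), integral_const_mul, integral_const_mul, ex, ey]
  ring

/-! ### Propagation of zeros through a connected set. -/

theorem VanishesToInfiniteOrder.of_ae_eq_zero {v : ℂ → ℂ} {q : ℝ≥0∞} {c : ℂ} {r : ℝ} (hr : 0 < r)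
    (h : ∀ᵐ z ∂(volume.restrict (ball c r)), v z = 0) : VanishesToInfiniteOrder v q c := by
  intro n
  refine ⟨0, ?_⟩
  filter_upwards [nhdsWithin_le_nhds (Iio_mem_nhds hr)] with ε hε
  have : v =ᵐ[volume.restrict (ball c ε)] 0 :=
    ae_restrict_of_ae_restrict_of_subset (ball_subset_ball (le_of_lt hε)) h
  rw [eLpNorm_congr_ae this]
  simp

/-- An `L²_loc` function has small `L²` norm on small balls. -/
theorem MemLpLoc.exists_closedBall_eLpNorm_le {U : ℂ → ℂ} {Ω : Opens ℂ} (hU : MemLpLoc U 2 Ω) {x : ℂ}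
    (hx : x ∈ Ω) {u : ℝ≥0∞} (hu : u ≠ 0) :
    ∃ R : ℝ, 0 < R ∧ closedBall x R ⊆ (Ω : Set ℂ) ∧
      eLpNorm U 2 (volume.restrict (closedBall x R)) ≤ u := by
  obtain ⟨R₀, hR₀, hsub⟩ := Metric.nhds_basis_closedBall.mem_iff.1 (Ω.isOpen.mem_nhds hx)
  have hm := hU _ (isCompact_closedBall x R₀) hsub
  have hfin : ∫⁻ z in closedBall x R₀, ‖U z‖ₑ ^ (2 : ℝ) ≠ ∞ := by
    have := lintegral_rpow_enorm_lt_top_of_eLpNorm_lt_top (by simp) (by simp) hm.2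
    simpa using this.ne
  -- Absolute continuity of the integral of |U|².
  obtain ⟨d, hd, hsmall⟩ := exists_pos_setLIntegral_lt_of_measure_lt hfin
    (ε := u ^ (2 : ℝ)) (by simpa using hu)
  have hv : Tendsto (fun R : ℝ => volume (closedBall x R)) (𝓝[>] 0) (𝓝 0) := by
    have h1 : Tendsto (fun R : ℝ => ENNReal.ofReal R ^ 2 * NNReal.pi) (𝓝 0)
        (𝓝 (ENNReal.ofReal 0 ^ 2 * NNReal.pi)) :=
      ENNReal.Tendsto.mul_const (ENNReal.Tendsto.pow (ENNReal.tendsto_ofReal tendsto_id)) (Or.inr (by simp))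
    simp_rw [Complex.volume_closedBall]
    simpa using h1.mono_left (nhdsWithin_le_nhds (s := Set.Ioi 0))
  obtain ⟨R, hRd, hR0, hRR⟩ := ((hv.eventually (gt_mem_nhds hd)).and
    ((eventually_mem_nhdsWithin).and (nhdsWithin_le_nhds (Iio_mem_nhds hR₀)))).exists
  have hRR : R < R₀ := hRR
  have hsub' := closedBall_subset_closedBall (x := x) hRR.le
  refine ⟨R, hR0, hsub'.trans hsub, ?_⟩
  have h2 := hsmall (closedBall x R) ((Measure.restrict_apply_le _ _).trans_lt hRd)
  rw [Measure.restrict_restrict measurableSet_closedBall, Set.inter_eq_left.2 hsub'] at h2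
  rw [eLpNorm_eq_lintegral_rpow_enorm_toReal (by simp) (by simp)]
  simp only [ENNReal.toReal_ofNat]
  calc _ ≤ (u ^ (2 : ℝ)) ^ (1 / 2 : ℝ) := by gcongr
    _ = u := by rw [← ENNReal.rpow_mul]; norm_num

/-- **Strong unique continuation** for a pair of functions with `|∂̄v₁| ≤ |U| |v₂|` and
`|∂̄v₂| ≤ |U| |v₁|`. -/
theorem ae_eq_zero_of_vanishesToInfiniteOrder {p : ℝ} (hp1 : 1 < p) (hp2 : p < 2) {Ω : Opens ℂ}
    (hΩ : IsConnected (Ω : Set ℂ)) {v₁ v₂ g₁ g₂ U : ℂ → ℂ} (hU : MemLpLoc U 2 Ω)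
    (hw₁ : HasWeakDbar Ω v₁ g₁) (hw₂ : HasWeakDbar Ω v₂ g₂)
    (hv₁ : MemLpLoc v₁ (ENNReal.ofReal p) Ω) (hv₂ : MemLpLoc v₂ (ENNReal.ofReal p) Ω)
    (hg₁ : MemLpLoc g₁ (ENNReal.ofReal p) Ω) (hg₂ : MemLpLoc g₂ (ENNReal.ofReal p) Ω)
    (hb₁ : ∀ᵐ z ∂(volume.restrict (Ω : Set ℂ)), ‖g₁ z‖ ≤ ‖U z‖ * ‖v₂ z‖)
    (hb₂ : ∀ᵐ z ∂(volume.restrict (Ω : Set ℂ)), ‖g₂ z‖ ≤ ‖U z‖ * ‖v₁ z‖) {c₀ : ℂ} (hc₀ : c₀ ∈ Ω)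
    (hd₁ : VanishesToInfiniteOrder v₁ (ENNReal.ofReal (2 * p / (2 - p))) c₀)
    (hd₂ : VanishesToInfiniteOrder v₂ (ENNReal.ofReal (2 * p / (2 - p))) c₀) :
    ∀ᵐ z ∂(volume.restrict (Ω : Set ℂ)), v₁ z = 0 ∧ v₂ z = 0 := by
  obtain ⟨u, hu, H⟩ := exists_ae_eq_zero_of_vanishesToInfiniteOrder hp1 hp2
  set Z : Set ℂ := {x | ∃ ε > 0, ∀ᵐ z ∂(volume.restrict (ball x ε)), v₁ z = 0 ∧ v₂ z = 0} with hZ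
  have hZo : IsOpen Z := by
    rw [Metric.isOpen_iff]
    rintro x ⟨ε, hε, hx⟩
    refine ⟨ε / 2, by positivity, fun y hy => ⟨ε / 2, by positivity, ?_⟩⟩
    refine ae_restrict_of_ae_restrict_of_subset (ball_subset_ball' ?_) hx
    have : dist y x < ε / 2 := hy
    linarith
  have loc : ∀ (c : ℂ) (r : ℝ), 0 < r → closedBall c (2 * r) ⊆ (Ω : Set ℂ) →
      eLpNorm U 2 (volume.restrict (closedBall c (2 * r))) ≤ u →
      VanishesToInfiniteOrder v₁ (ENNReal.ofReal (2 * p / (2 - p))) c →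
      VanishesToInfiniteOrder v₂ (ENNReal.ofReal (2 * p / (2 - p))) c →
      ∀ᵐ z ∂(volume.restrict (closedBall c (r / 2))), v₁ z = 0 ∧ v₂ z = 0 :=
    fun c r hr hsub hsm h1 h2 => H Ω v₁ v₂ g₁ g₂ U c r hr hsub hw₁ hw₂ hv₁ hv₂ hg₁ hg₂ hb₁ hb₂
      (hU _ (isCompact_closedBall _ _) hsub).1 hsm h1 h2
  have h0 : c₀ ∈ Z := by
    obtain ⟨R, hR, hsub, hsm⟩ := hU.exists_closedBall_eLpNorm_le hc₀ hu
    refine ⟨R / 4, by positivity, ?_⟩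
    have e : 2 * (R / 2) = R := by ring
    have := loc c₀ (R / 2) (by positivity) (by rwa [e]) (by rwa [e]) hd₁ hd₂
    exact ae_restrict_of_ae_restrict_of_subset
      (ball_subset_closedBall.trans (closedBall_subset_closedBall (by linarith))) this
  have hsubZ : (Ω : Set ℂ) ⊆ Z := by
    refine hΩ.isPreconnected.subset_of_closure_inter_subset hZo ⟨c₀, hc₀, h0⟩ ?_
    rintro x ⟨hxZ, hxΩ⟩
    obtain ⟨R, hR, hsub, hsm⟩ := hU.exists_closedBall_eLpNorm_le hxΩ hu
    -- A centre c in Z within R/16 of x: the ball of radius R/2 around c stays in the ball of radius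
    -- R around x, and the vanishing on radius R/8 around c covers radius R/16 around x.
    obtain ⟨c, ⟨ε, hε, hc⟩, hcx⟩ := Metric.mem_closure_iff.1 hxZ (R / 16) (by positivity)
    rw [dist_comm] at hcx
    have hin : closedBall c (2 * (R / 4)) ⊆ closedBall x R :=
      closedBall_subset_closedBall' (by linarith)
    have h1 : ∀ᵐ z ∂(volume.restrict (ball c ε)), v₁ z = 0 := hc.mono fun z hz => hz.1
    have h2 : ∀ᵐ z ∂(volume.restrict (ball c ε)), v₂ z = 0 := hc.mono fun z hz => hz.2
    have := loc c (R / 4) (by positivity) (hin.trans hsub)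
      ((eLpNorm_mono_measure _ (Measure.restrict_mono hin le_rfl)).trans hsm)
      (.of_ae_eq_zero hε h1) (.of_ae_eq_zero hε h2)
    refine ⟨R / 16, by positivity, ae_restrict_of_ae_restrict_of_subset ?_ this⟩
    refine ball_subset_closedBall.trans (closedBall_subset_closedBall' ?_)
    rw [dist_comm] at hcx
    linarith
  rw [ae_restrict_iff' Ω.isOpen.measurableSet, ae_iff]
  apply measure_null_of_locally_null
  intro x hx
  have hxΩ : x ∈ (Ω : Set ℂ) := by
    by_contra h
    exact hx fun h' => (h h').elim
  obtain ⟨ε, hε, h⟩ := hsubZ hxΩ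
  refine ⟨_, inter_mem_nhdsWithin _ (ball_mem_nhds x hε), ?_⟩
  rw [ae_restrict_iff' measurableSet_ball, ae_iff] at h
  refine measure_mono_null ?_ h
  rintro z ⟨hz1, hz2⟩ hz3
  exact hz1 fun _ => hz3 hz2

/-! ### Reduction of the spinor equation to a pair of ∂̄-inequalities. -/

theorem mainTheorem9 (Ω : Opens ℂ) (hΩ : IsConnected (Ω : Set ℂ)) (h0 : (0 : ℂ) ∈ Ω)
    (U : ℂ → ℂ) (hU : MemLpLoc U 2 Ω)
    (p : ℝ) (hp1 : 1 < p) (hp2 : p < 2)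
    (ψ : Spinor) (hψ : MemSobolevLoc ψ (ENNReal.ofReal p) Ω) (hker : InKernel Ω U ψ)
    (hdecay : ∀ n : ℕ, ∃ C : ℝ, ∀ᶠ ε : ℝ in 𝓝[>] 0,
      eLpNorm ψ (ENNReal.ofReal (2 * p / (2 - p))) (volume.restrict (ball (0 : ℂ) ε))
        ≤ ENNReal.ofReal (C * ε ^ n)) :
    ∀ᵐ z ∂(volume.restrict (Ω : Set ℂ)), ψ z = 0 := by
  obtain ⟨hψp, fx, fy, hfx, hfy, hdx, hdy⟩ := hψ
  obtain ⟨hψ1, ψx, ψy, hψx, hψy, hex, hey, heq⟩ := hker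
  have hp : (1 : ℝ≥0∞) ≤ ENNReal.ofReal p := by simpa using hp1.le
  have ax := hdx.ae_eq hex (hfx.mono_exponent hp) hψx
  have ay := hdy.ae_eq hey (hfy.mono_exponent hp) hψy
  -- The components ψ₁ and conj ψ₂. Conjugation is only real-linear, which suffices for weak
  -- derivatives to pass through.
  let L₁ : EuclideanSpace ℂ (Fin 2) →L[ℝ] ℂ := (EuclideanSpace.proj (𝕜 := ℂ) (0 : Fin 2)).restrictScalars ℝ
  let L₂ : EuclideanSpace ℂ (Fin 2) →L[ℝ] ℂ :=
    (Complex.conjCLE : ℂ →L[ℝ] ℂ).comp ((EuclideanSpace.proj (𝕜 := ℂ) (1 : Fin 2)).restrictScalars ℝ)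
  have dbarL : ∀ L : EuclideanSpace ℂ (Fin 2) →L[ℝ] ℂ, HasWeakDbar Ω (fun z => L (ψ z))
      (fun z => (L (fx z) + Complex.I * L (fy z)) / 2) := fun L =>
    (hdx.clm_comp hψ1 (hfx.mono_exponent hp) L).hasWeakDbar
      (hdy.clm_comp hψ1 (hfy.mono_exponent hp) L) (hψ1.clm_comp L)
      ((hfx.mono_exponent hp).clm_comp L) ((hfy.mono_exponent hp).clm_comp L)
  have memL : ∀ L : EuclideanSpace ℂ (Fin 2) →L[ℝ] ℂ,
      MemLpLoc (fun z => (L (fx z) + Complex.I * L (fy z)) / 2) (ENNReal.ofReal p) Ω := by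
    intro L K hK hKΩ
    have := (((hfx.clm_comp L) K hK hKΩ).add
      (((hfy.clm_comp L) K hK hKΩ).const_mul Complex.I)).const_mul (2 : ℂ)⁻¹
    simp only [div_eq_inv_mul]
    exact this
  have decL : ∀ L : EuclideanSpace ℂ (Fin 2) →L[ℝ] ℂ, (∀ w, ‖L w‖ ≤ ‖w‖) →
      VanishesToInfiniteOrder (fun z => L (ψ z)) (ENNReal.ofReal (2 * p / (2 - p))) 0 := by
    intro L hL n
    obtain ⟨C, hC⟩ := hdecay n
    refine ⟨C, hC.mono fun ε hε => le_trans (eLpNorm_mono fun z => hL _) hε⟩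
  have hL₁ : ∀ w, ‖L₁ w‖ ≤ ‖w‖ := fun w => PiLp.norm_apply_le w 0
  have hL₂ : ∀ w, ‖L₂ w‖ ≤ ‖w‖ := fun w => by
    have := PiLp.norm_apply_le w 1
    simpa [L₂] using this
  have b₁ : ∀ᵐ z ∂(volume.restrict (Ω : Set ℂ)),
      ‖(L₁ (fx z) + Complex.I * L₁ (fy z)) / 2‖ ≤ ‖U z‖ * ‖L₂ (ψ z)‖ := by
    filter_upwards [ax, ay, heq] with z h1 h2 h3
    have h4 : (ψx z 0 + Complex.I * ψy z 0) / 2 - conj (U z) * ψ z 1 = 0 := by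
      simpa [holStructure] using congrArg (fun w : EuclideanSpace ℂ (Fin 2) => w 0) h3
    have h5 : (L₁ (fx z) + Complex.I * L₁ (fy z)) / 2 = conj (U z) * ψ z 1 := by
      rw [h1, h2]
      exact sub_eq_zero.1 h4
    rw [h5]
    simp [L₂]
  have b₂ : ∀ᵐ z ∂(volume.restrict (Ω : Set ℂ)),
      ‖(L₂ (fx z) + Complex.I * L₂ (fy z)) / 2‖ ≤ ‖U z‖ * ‖L₁ (ψ z)‖ := by
    filter_upwards [ax, ay, heq] with z h1 h2 h3
    have h4 : U z * ψ z 0 + (ψx z 1 - Complex.I * ψy z 1) / 2 = 0 := by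
      simpa [holStructure] using congrArg (fun w : EuclideanSpace ℂ (Fin 2) => w 1) h3
    have h5 : (L₂ (fx z) + Complex.I * L₂ (fy z)) / 2 =
        conj ((ψx z 1 - Complex.I * ψy z 1) / 2) := by
      rw [h1, h2]
      simp [L₂, Complex.conj_ofNat]
    rw [h5, show (ψx z 1 - Complex.I * ψy z 1) / 2 = - (U z * ψ z 0) by linear_combination h4]
    simp [L₁]
  have key := ae_eq_zero_of_vanishesToInfiniteOrder hp1 hp2 hΩ hU (dbarL L₁) (dbarL L₂)
    (hψp.clm_comp L₁) (hψp.clm_comp L₂) (memL L₁) (memL L₂) b₁ b₂ h0 (decL L₁ hL₁) (decL L₂ hL₂)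
  filter_upwards [key] with z hz
  ext j
  fin_cases j
  · simpa [L₁] using hz.1
  · simpa [L₂] using hz.2
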